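/- For an integer $\ell\ge 2$, the cycle of length $2\ell$ with all diagonals is the graph $C^{\mathrm{dia}}_{2\ell}$ with vertices $x_1,\dots,x_{2\ell}$ whose edges are those of the cycle $x_1x_2\cdots x_{2\ell}x_1$ together with all chords $x_ix_{i+\ell}$, $1\le i\le \ell$. A graph contains a cycle with all diagonals if it has a (not necessarily induced) subgraph isomorphic to $C^{\mathrm{dia}}_{2\ell}$ for some $\ell\ge 2$. All graphs are finite and simple. (1) There is an absolute constant $C>0$ such that, for every $n\ge 1$, every $n$-vertex graph with at least $Cn^{3/2}$ edges contains a cycle with all diagonals. (2) For every $\ell\ge 2$, the graph $C^{\mathrm{dia}}_{2\ell}$ contains a four-cycle as a subgraph. (3) The order $n^{3/2}$ in (1) is best possible: there is an absolute constant $c>0$ such that, for every $n\ge 2$, some $n$-vertex graph with at least $cn^{3/2}$ edges contains no cycle with all diagonals. -/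

import Mathlib

open scoped SimpleGraph

/-- The cycle of length `2 * ℓ` with all diagonals: on the vertices `0, …, 2ℓ - 1`, the edges of
the cycle together with the `ℓ` chords joining `i` and `i + ℓ` for `0 ≤ i < ℓ`. It is the intended
graph only for `2 ≤ ℓ`, since a cycle of even length has length at least four. -/
def cycleDiag (ℓ : ℕ) : SimpleGraph (Fin (2 * ℓ)) :=
  SimpleGraph.cycleGraph (2 * ℓ) ⊔ SimpleGraph.fromRel (fun i j => (j : ℕ) = (i : ℕ) + ℓ)

/-- `G` contains a cycle with all diagonals as a (not necessarily induced) subgraph. -/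
def HasCycleDiag {V : Type*} (G : SimpleGraph V) : Prop :=
  ∃ ℓ : ℕ, 2 ≤ ℓ ∧ cycleDiag ℓ ⊑ G

/-! ### Closed walks on edges, `K_{3,3}` and four-cycles. -/

section Embeddings

variable {V : Type*} {G : SimpleGraph V}

/-! For odd `ℓ`, the cycle of length `2ℓ` with all diagonals is a Möbius ladder whose rungs are the
diagonals. Consider the auxiliary graph on ordered edges in which `(x, y)` is joined to `(x', y')`
when `x y x' y'` is a four-cycle. A closed walk of odd length in it whose edges are pairwise
disjoint is exactly such a ladder (`hasCycleDiag_of_walk`). The upper bound finds such a walk by a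
trace argument.

Suppose a dense graph on `n` vertices has no cycle with all diagonals. Then it has no `K_{3,3}`,
which is the case of length six. This allows passing to a subgraph of maximum degree `O(n ^ (2/3))`
with half of the required edges (`exists_subgraph_degree_le`), and then to one in which every edge
lies in at least `n ^ (1/2)` four-cycles, and in many more than the sum of the degrees of its ends
(`exists_subgraph_many_four_cycles`). Four-cycles with a diagonal of codegree at least `τ`, of order
`n ^ (1/3)`, are few at each edge, again because there is no `K_{3,3}`, and are discarded.

Normalise the auxiliary adjacency matrix by degrees. Its top eigenvalue is close to `1`, while a
sum-of-squares identity (`four_cycle_form_lower_bound`) keeps all eigenvalues above about `-1/2`, so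
that even for odd `ℓ` the trace of the `ℓ`-th power is large. Closed walks that meet a vertex `u` at
two different times contribute little: reaching the edges at `u` in a single light step has relative
weight `O(τ / n ^ (1/2)) = O(n ^ (-1/6))`, and a spectral rearrangement reduces any return time to
two steps. A length `ℓ` of order `n ^ (1/24)` is short enough for the sum over all pairs of times to
stay small and long enough for the top eigenvalue to dominate (`exists_closed_walk`).

For the lower bound, every cycle with all diagonals contains a four-cycle, so point-line incidence
graphs of affine planes are extremal up to a constant. -/

theorem hasCycleDiag_of_seq {ℓ : ℕ} (hℓ : 2 ≤ ℓ) (z : ℕ → V)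
    (inj : ∀ i < 2 * ℓ, ∀ j < 2 * ℓ, z i = z j → i = j)
    (adj : ∀ i, G.Adj (z i) (z (i + 1))) (last : z (2 * ℓ) = z 0)
    (chord : ∀ i, G.Adj (z i) (z (i + ℓ))) : HasCycleDiag G := by
  have key : ∀ u v : Fin (2 * ℓ), ((u - v : Fin (2 * ℓ)) : ℕ) = 1 →
      G.Adj (z v) (z u) := by
    intro u v h
    rw [Fin.val_sub] at h
    have hu := u.isLt
    have hv := v.isLt
    rcases lt_or_ge (u : ℕ) v with huv | huv
    · rw [Nat.mod_eq_of_lt (by omega)] at h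
      have h1 : (v : ℕ) + 1 = 2 * ℓ := by omega
      have h2 : (u : ℕ) = 0 := by omega
      have := adj v
      rwa [h1, last, ← h2] at this
    · rw [show 2 * ℓ - (v : ℕ) + u = (u - v) + 2 * ℓ by omega, Nat.add_mod_right,
        Nat.mod_eq_of_lt (by omega)] at h
      have h1 : (u : ℕ) = v + 1 := by omega
      rw [h1]
      exact adj v
  refine ⟨ℓ, hℓ, ⟨⟨⟨fun i => z i, ?_⟩, fun i j h => Fin.ext (inj i i.isLt j j.isLt h)⟩⟩⟩
  intro u v h
  rcases h with h | h
  · rw [SimpleGraph.cycleGraph_adj'] at h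
    rcases h with h | h
    · exact (key _ _ h).symm
    · exact key _ _ h
  · rw [SimpleGraph.fromRel_adj] at h
    rcases h with ⟨-, h | h⟩
    · rw [h]
      exact chord u
    · rw [h]
      exact (chord v).symm

/-- A closed walk of odd length on ordered edges, each step going between opposite edges of a
four-cycle, gives a cycle with all diagonals as soon as its edges are pairwise disjoint. -/
theorem hasCycleDiag_of_walk {k : ℕ} (hk : 1 ≤ k) (p : ℕ → V × V)
    (h0 : ∀ i < 2 * k + 1, G.Adj (p i).1 (p i).2)
    (h1 : ∀ i < 2 * k + 1, G.Adj (p i).1 (p (i + 1)).2)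
    (h2 : ∀ i < 2 * k + 1, G.Adj (p i).2 (p (i + 1)).1)
    (hp : p (2 * k + 1) = p 0)
    (hd : ∀ i < 2 * k + 1, ∀ j < i, (p i).1 ≠ (p j).1 ∧ (p i).1 ≠ (p j).2 ∧
      (p i).2 ≠ (p j).1 ∧ (p i).2 ≠ (p j).2) : HasCycleDiag G := by
  set ℓ := 2 * k + 1 with hℓ
  have hmod : ∀ i, i % ℓ < ℓ := fun i => Nat.mod_lt _ (by omega)
  have hsucc : ∀ i, p ((i + 1) % ℓ) = p (i % ℓ + 1) := by
    intro i
    have := hmod i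
    rcases (show i % ℓ + 1 < ℓ ∨ i % ℓ + 1 = ℓ by omega) with h | h
    · rw [← Nat.mod_add_mod, Nat.mod_eq_of_lt h]
    · rw [← Nat.mod_add_mod, h, Nat.mod_self, hp]
  have hpar : ∀ i, Even (i + ℓ) ↔ ¬ Even i := by
    intro i
    rw [hℓ]
    simp [Nat.even_add]
  have hsymm : ∀ i < ℓ, ∀ j < ℓ, i ≠ j → (p i).1 ≠ (p j).1 ∧ (p i).1 ≠ (p j).2 ∧
      (p i).2 ≠ (p j).1 ∧ (p i).2 ≠ (p j).2 := by
    intro i hi j hj hij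
    rcases lt_or_gt_of_ne hij with h | h
    · obtain ⟨a, b, c, d⟩ := hd j hj i h
      exact ⟨a.symm, c.symm, b.symm, d.symm⟩
    · exact hd i hi j h
  -- The cycle goes round the walk twice, taking alternately first and second ends. As `ℓ` is odd,
  -- the two visits to an edge use its two ends, so each diagonal is an edge of the walk.
  refine hasCycleDiag_of_seq (ℓ := ℓ) (by omega)
    (fun i => if Even i then (p (i % ℓ)).1 else (p (i % ℓ)).2) ?_ ?_ ?_ ?_
  · intro i hi j hj hij
    by_cases hm : i % ℓ = j % ℓ
    · by_contra hne
      have hcase : i = j + ℓ ∨ j = i + ℓ := by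
        have e1 := Nat.div_add_mod i ℓ
        have e2 := Nat.div_add_mod j ℓ
        have d1 : i / ℓ < 2 := by rw [Nat.div_lt_iff_lt_mul (by omega)]; omega
        have d2 : j / ℓ < 2 := by rw [Nat.div_lt_iff_lt_mul (by omega)]; omega
        rcases Nat.le_one_iff_eq_zero_or_eq_one.1 (Nat.lt_succ_iff.1 d1) with a | a <;>
        rcases Nat.le_one_iff_eq_zero_or_eq_one.1 (Nat.lt_succ_iff.1 d2) with b | b <;>
        rw [a] at e1 <;> rw [b] at e2 <;> omega
      have hne' : (p (j % ℓ)).1 ≠ (p (j % ℓ)).2 := (h0 _ (hmod j)).ne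
      have hpp : Even i ↔ ¬ Even j := by
        rcases hcase with h | h
        · rw [h, hpar]
        · rw [h, hpar, not_not]
      simp only [hm, hpp] at hij
      by_cases hj : Even j
      · simp [hj] at hij
        exact hne' hij.symm
      · simp [hj] at hij
        exact hne' hij
    · obtain ⟨a, b, c, d⟩ := hsymm _ (hmod i) _ (hmod j) hm
      by_cases hi : Even i <;> by_cases hj : Even j <;> simp [hi, hj] at hij <;> contradiction
  · intro i
    by_cases hi : Even i
    · simp only [hi, Nat.even_add_one, not_true, if_true, if_false, hsucc]
      exact h1 _ (hmod i)
    · simp only [hi, Nat.even_add_one, not_false_eq_true, if_true, if_false, hsucc]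
      exact h2 _ (hmod i)
  · simp
  · intro i
    by_cases hi : Even i
    · simp only [hi, hpar, not_true, if_true, if_false, Nat.add_mod_right]
      exact h0 _ (hmod i)
    · simp only [hi, hpar, not_false_eq_true, if_true, if_false, Nat.add_mod_right]
      exact (h0 _ (hmod i)).symm

/-- `K_{3,3}` is the six-cycle with all diagonals: a perfect matching of it, in any order, is a
closed walk of length three. -/
theorem hasCycleDiag_of_completeBipartite {a b c x y z : V} (hab : a ≠ b) (hac : a ≠ c)
    (hbc : b ≠ c) (hxy : x ≠ y) (hxz : x ≠ z) (hyz : y ≠ z)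
    (hax : G.Adj a x) (hay : G.Adj a y) (haz : G.Adj a z)
    (hbx : G.Adj b x) (hby : G.Adj b y) (hbz : G.Adj b z)
    (hcx : G.Adj c x) (hcy : G.Adj c y) (hcz : G.Adj c z) : HasCycleDiag G := by
  have n1 := hax.ne
  have n2 := hay.ne
  have n3 := haz.ne
  have n4 := hbx.ne
  have n5 := hby.ne
  have n6 := hbz.ne
  have n7 := hcx.ne
  have n8 := hcy.ne
  have n9 := hcz.ne
  refine hasCycleDiag_of_walk (k := 1) le_rfl
    (fun i => if i % 3 = 0 then (a, y) else if i % 3 = 1 then (c, x) else (b, z)) ?_ ?_ ?_ rfl ?_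
  · intro i hi
    interval_cases i <;> simp [hay, hbz, hcx]
  · intro i hi
    interval_cases i <;> simp [hax, hcz, hby]
  · intro i hi
    interval_cases i <;> simp [haz.symm, hcy.symm, hbx.symm]
  · intro i hi j hj
    interval_cases i <;> interval_cases j <;> simp <;>
      refine ⟨?_, ?_, ?_, ?_⟩ <;> first | assumption | (apply Ne.symm; assumption)

theorem cycleGraph_four_isContained {a b c d : V} (hac : a ≠ c) (hbd : b ≠ d) (hab : G.Adj a b)
    (hbc : G.Adj b c) (hcd : G.Adj c d) (hda : G.Adj d a) : SimpleGraph.cycleGraph 4 ⊑ G := by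
  have n1 := hab.ne
  have n2 := hbc.ne
  have n3 := hcd.ne
  have n4 := hda.ne
  refine ⟨⟨⟨![a, b, c, d], ?_⟩, ?_⟩⟩
  · intro i j h
    rw [SimpleGraph.cycleGraph_adj] at h
    fin_cases i <;> fin_cases j <;>
      first
      | exact absurd h (by decide)
      | assumption
      | (apply SimpleGraph.Adj.symm; assumption)
  · intro i j h
    fin_cases i <;> fin_cases j <;> simp_all [eq_comm]

theorem cycleGraph_four_isContained_cycleDiag {ℓ : ℕ} (hℓ : 2 ≤ ℓ) :
    SimpleGraph.cycleGraph 4 ⊑ cycleDiag ℓ := by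
  have succ : ∀ (i : ℕ) (h : i + 1 < 2 * ℓ),
      (cycleDiag ℓ).Adj ⟨i, by omega⟩ ⟨i + 1, h⟩ := by
    intro i h
    left
    rw [SimpleGraph.cycleGraph_adj']
    right
    rw [Fin.val_sub]
    change (2 * ℓ - i + (i + 1)) % (2 * ℓ) = 1
    rw [show 2 * ℓ - i + (i + 1) = 1 + 2 * ℓ by omega, Nat.add_mod_right,
      Nat.mod_eq_of_lt (by omega)]
  have chord : ∀ (i : ℕ) (h : i + ℓ < 2 * ℓ),
      (cycleDiag ℓ).Adj ⟨i, by omega⟩ ⟨i + ℓ, h⟩ := by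
    intro i h
    right
    rw [SimpleGraph.fromRel_adj]
    refine ⟨fun h => ?_, Or.inl rfl⟩
    have := congrArg Fin.val h
    simp at this
    omega
  refine cycleGraph_four_isContained (a := ⟨0, by omega⟩) (b := ⟨1, by omega⟩)
    (c := ⟨1 + ℓ, by omega⟩) (d := ⟨0 + ℓ, by omega⟩) ?_ ?_ (succ 0 (by omega)) (chord 1 (by omega))
    ?_ (chord 0 (by omega)).symm
  · simp; omega
  · simp; omega
  · have := (succ (0 + ℓ) (by omega)).symm
    convert this using 2
    omega

theorem exists_four_cycle_of_cycleGraph_four_isContained (h : SimpleGraph.cycleGraph 4 ⊑ G) :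
    ∃ a b c d : V, a ≠ c ∧ b ≠ d ∧ G.Adj a b ∧ G.Adj b c ∧ G.Adj c d ∧ G.Adj d a := by
  obtain ⟨f⟩ := h
  refine ⟨f 0, f 1, f 2, f 3, fun h => absurd (f.injective' h) (by decide),
    fun h => absurd (f.injective' h) (by decide), ?_, ?_, ?_, ?_⟩ <;>
  exact f.toHom.map_rel (by rw [SimpleGraph.cycleGraph_adj]; decide)

end Embeddings

/-! ### Trace method for closed walks without returns. -/

section Spectral

open Matrix Finset

variable {ι : Type*} [Fintype ι]

/-- An eigenvalue of at least `9/10` loses at most half of its power, since `c ≤ 4/10 < (9/10) ^ 2 /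
2`. Every other one is at most `9/10` in absolute value, thanks to the bound `-6/10`, and costs at
most `2 * (9/10) ^ (ℓ - 2)`. By `hN` the total cost is at most the half retained at `i₀`. -/
theorem sum_pow_sub_pos {μ : ι → ℝ} {c : ℝ} (hμ : ∀ i, -(6 / 10) ≤ μ i) {i₀ : ι}
    (hi₀ : 95 / 100 ≤ μ i₀) (hc0 : 0 ≤ c) (hc : c ≤ 4 / 10) {ℓ : ℕ} (hℓ : 2 ≤ ℓ)
    (hN : 4 * (Fintype.card ι : ℝ) * (9 / 10) ^ (ℓ - 2) ≤ (95 / 100) ^ ℓ) :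
    c * ∑ i, |μ i| ^ (ℓ - 2) < ∑ i, μ i ^ ℓ := by
  obtain ⟨m, rfl⟩ := Nat.exists_eq_add_of_le' hℓ
  rw [Nat.add_sub_cancel] at hN ⊢
  set q : ℝ := (9 / 10) ^ m with hq
  have hq0 : 0 < q := by positivity
  have large : ∀ i, 9 / 10 ≤ μ i → μ i ^ (m + 2) / 2 ≤ μ i ^ (m + 2) - c * |μ i| ^ m := by
    intro i hi
    rw [abs_of_nonneg (by linarith), pow_add]
    have h1 : 0 ≤ μ i ^ m := pow_nonneg (by linarith) _
    have h2 : c ≤ μ i ^ 2 / 2 := by nlinarith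
    nlinarith [mul_le_mul_of_nonneg_left h2 h1]
  have all : ∀ i, 0 ≤ μ i ^ (m + 2) - c * |μ i| ^ m + 2 * q := by
    intro i
    rcases le_or_gt (9 / 10) (μ i) with hi | hi
    · have := large i hi
      have : 0 ≤ μ i ^ (m + 2) := pow_nonneg (by linarith) _
      linarith
    · have habs : |μ i| ≤ 9 / 10 := abs_le.2 ⟨by linarith [hμ i], hi.le⟩
      have h1 : |μ i| ^ m ≤ q := pow_le_pow_left₀ (abs_nonneg _) habs _
      have h2 : |μ i ^ (m + 2)| ≤ q := by
        rw [abs_pow, pow_add]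
        have h3 : |μ i| ^ 2 ≤ 1 := pow_le_one₀ (abs_nonneg _) (by linarith)
        nlinarith [pow_nonneg (abs_nonneg (μ i)) m]
      have := neg_le_of_abs_le h2
      nlinarith [pow_nonneg (abs_nonneg (μ i)) m]
  have hsum : μ i₀ ^ (m + 2) - c * |μ i₀| ^ m + 2 * q ≤
      ∑ i, (μ i ^ (m + 2) - c * |μ i| ^ m + 2 * q) :=
    single_le_sum (f := fun i => μ i ^ (m + 2) - c * |μ i| ^ m + 2 * q)
      (fun i _ => all i) (mem_univ i₀)
  rw [sum_add_distrib, sum_sub_distrib, ← mul_sum, sum_const, card_univ, nsmul_eq_mul] at hsum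
  have htop := large i₀ (by linarith)
  have : (95 / 100 : ℝ) ^ (m + 2) ≤ μ i₀ ^ (m + 2) := pow_le_pow_left₀ (by norm_num) hi₀ _
  nlinarith

variable [DecidableEq ι]

theorem prod_range_map_apply (A : ℕ → Matrix ι ι ℝ) (k : ℕ) (a b : ι) :
    ((List.range k).map A).prod a b =
      ∑ w : Fin (k + 1) → ι, if w 0 = a ∧ w (Fin.last k) = b then
        ∏ i : Fin k, A i (w i.castSucc) (w i.succ) else 0 := by
  induction k generalizing b with
  | zero =>
    rw [← (Equiv.funUnique (Fin 1) ι).symm.sum_comp]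
    simp [Matrix.one_apply, ite_and]
  | succ k ih =>
    rw [List.range_succ, List.map_append, List.prod_append, List.map_singleton,
      List.prod_singleton, Matrix.mul_apply,
      ← (Fin.snocEquiv (fun _ : Fin (k + 2) => ι)).sum_comp, Fintype.sum_prod_type]
    simp only [ih, sum_mul, Fin.snocEquiv_apply, Fin.snoc_last]
    rw [sum_comm]
    conv_rhs => rw [sum_comm]
    refine sum_congr rfl fun w _ => ?_
    have h0 : ∀ c : ι, (Fin.snoc (α := fun _ => ι) w c : Fin (k + 2) → ι) 0 = w 0 := fun c =>
      Fin.snoc_castSucc (α := fun _ => ι) c w 0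
    simp only [Fin.prod_univ_castSucc, Fin.snoc_castSucc, h0, Fin.succ_last, Fin.snoc_last,
      ← Fin.castSucc_succ]
    by_cases h : w 0 = a <;> simp [h]

theorem trace_prod_range_map (A : ℕ → Matrix ι ι ℝ) (k : ℕ) :
    ((List.range k).map A).prod.trace =
      ∑ w : Fin (k + 1) → ι, if w 0 = w (Fin.last k) then
        ∏ i : Fin k, A i (w i.castSucc) (w i.succ) else 0 := by
  simp only [Matrix.trace, Matrix.diag, prod_range_map_apply]
  rw [sum_comm]
  refine sum_congr rfl fun w _ => ?_
  simp only [ite_and]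
  simp [eq_comm]

/-- With `Q` the projection onto a set of indices, the product weighs the walks that are in this set
at times `i` and `j`. After a cyclic rotation its trace depends only on `j - i`. -/
theorem prod_range_map_insert (P Q : Matrix ι ι ℝ) {i j k : ℕ} (hij : i < j) (hjk : j < k) :
    ((List.range k).map fun t => if t = i ∨ t = j then Q * P else P).prod =
      P ^ i * (Q * P ^ (j - i)) * (Q * P ^ (k - j)) := by
  obtain ⟨m, rfl⟩ : ∃ m, j = i + 1 + m := ⟨j - (i + 1), by omega⟩
  obtain ⟨r, rfl⟩ : ∃ r, k = i + 1 + m + 1 + r := ⟨k - (i + 1 + m + 1), by omega⟩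
  have const : ∀ (n s : ℕ) (f : ℕ → Matrix ι ι ℝ), (∀ t < n, f (s + t) = P) →
      ((List.range n).map (f ∘ fun t => s + t)).prod = P ^ n := by
    intro n s f h
    rw [List.map_congr_left (g := fun _ => P) (by simpa using h)]
    simp
  have h1 := const i 0 (fun t => if t = i ∨ t = i + 1 + m then Q * P else P)
    (fun t ht => if_neg (by omega))
  have h2 := const m (i + 1) (fun t => if t = i ∨ t = i + 1 + m then Q * P else P)
    (fun t ht => if_neg (by omega))
  have h3 := const r (i + 1 + m + 1) (fun t => if t = i ∨ t = i + 1 + m then Q * P else P)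
    (fun t ht => if_neg (by omega))
  simp only [Function.comp_def, zero_add] at h1
  simp only [List.range_add, List.map_append, List.prod_append, List.map_map, h1, h2, h3]
  rw [show i + 1 + m - i = m + 1 by omega,
    show i + 1 + m + 1 + r - (i + 1 + m) = r + 1 by omega]
  simp [List.range_succ, pow_succ', mul_assoc]

theorem exists_orthogonal_diagonalization {P : Matrix ι ι ℝ} (hP : P.IsSymm) :
    ∃ (U : Matrix ι ι ℝ) (μ : ι → ℝ), Uᵀ * U = 1 ∧ U * Uᵀ = 1 ∧ P = U * diagonal μ * Uᵀ := by
  have hH : P.IsHermitian := by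
    rw [Matrix.IsHermitian, conjTranspose_eq_transpose_of_trivial]
    exact hP
  refine ⟨hH.eigenvectorUnitary, hH.eigenvalues, ?_, ?_, ?_⟩
  · have := Unitary.coe_star_mul_self hH.eigenvectorUnitary
    rwa [Matrix.star_eq_conjTranspose, conjTranspose_eq_transpose_of_trivial] at this
  · have := Unitary.coe_mul_star_self hH.eigenvectorUnitary
    rwa [Unitary.coe_star, Matrix.star_eq_conjTranspose, conjTranspose_eq_transpose_of_trivial] at this
  · have := hH.spectral_theorem
    rwa [Unitary.conjStarAlgAut_apply, Matrix.star_eq_conjTranspose,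
      conjTranspose_eq_transpose_of_trivial] at this

theorem pow_conj_diagonal {U : Matrix ι ι ℝ} {μ : ι → ℝ} (hU : Uᵀ * U = 1) (hU' : U * Uᵀ = 1)
    (s : ℕ) : (U * diagonal μ * Uᵀ) ^ s = U * diagonal (fun i => μ i ^ s) * Uᵀ := by
  induction s with
  | zero => simp [hU']
  | succ s ih =>
    rw [pow_succ, ih]
    calc U * diagonal (fun i => μ i ^ s) * Uᵀ * (U * diagonal μ * Uᵀ)
        = U * diagonal (fun i => μ i ^ s) * (Uᵀ * U) * diagonal μ * Uᵀ := by
          simp only [mul_assoc]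
      _ = _ := by
          rw [hU, mul_one, mul_assoc U, diagonal_mul_diagonal]
          simp only [pow_succ]

theorem trace_pow_conj_diagonal {U : Matrix ι ι ℝ} {μ : ι → ℝ} (hU : Uᵀ * U = 1)
    (hU' : U * Uᵀ = 1) (s : ℕ) : ((U * diagonal μ * Uᵀ) ^ s).trace = ∑ i, μ i ^ s := by
  rw [pow_conj_diagonal hU hU', trace_mul_comm, ← mul_assoc, hU, one_mul, trace_diagonal]

theorem trace_mul_pow_mul_mul_pow {U : Matrix ι ι ℝ} {μ : ι → ℝ} (hU : Uᵀ * U = 1)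
    (hU' : U * Uᵀ = 1) {Q : Matrix ι ι ℝ} (hQ : Q.IsSymm) (s r : ℕ) :
    (Q * (U * diagonal μ * Uᵀ) ^ s * (Q * (U * diagonal μ * Uᵀ) ^ r)).trace =
      ∑ i, ∑ j, μ i ^ s * μ j ^ r * (Uᵀ * Q * U) i j ^ 2 := by
  have hT : (Uᵀ * Q * U)ᵀ = Uᵀ * Q * U := by
    rw [transpose_mul, transpose_mul, transpose_transpose, hQ.eq, mul_assoc]
  set T := Uᵀ * Q * U with hTdef
  have : (Q * (U * diagonal μ * Uᵀ) ^ s * (Q * (U * diagonal μ * Uᵀ) ^ r)).trace =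
      (diagonal (fun i => μ i ^ s) * T * (diagonal (fun i => μ i ^ r) * T)).trace := by
    rw [pow_conj_diagonal hU hU', pow_conj_diagonal hU hU', hTdef]
    calc (Q * (U * diagonal (fun i => μ i ^ s) * Uᵀ) *
          (Q * (U * diagonal (fun i => μ i ^ r) * Uᵀ))).trace
        = ((Q * U) * (diagonal (fun i => μ i ^ s) * (Uᵀ * Q * U) *
          diagonal (fun i => μ i ^ r) * Uᵀ)).trace := by simp only [mul_assoc]
      _ = _ := by rw [trace_mul_comm]; simp only [mul_assoc]
  rw [this]
  simp only [Matrix.trace, Matrix.diag, Matrix.mul_apply (M := diagonal (fun i => μ i ^ s) * T),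
    diagonal_mul]
  refine sum_congr rfl fun i _ => sum_congr rfl fun j _ => ?_
  have : T j i = T i j := congrFun (congrFun hT i) j
  rw [this]
  ring

/-- The differences `a ^ s - b ^ s` and `a ^ r - b ^ r` have the same sign. -/
theorem pow_mul_pow_add_le {a b : ℝ} (ha : 0 ≤ a) (hb : 0 ≤ b) (s r : ℕ) :
    a ^ (s + 2) * b ^ (r + 2) + a ^ (r + 2) * b ^ (s + 2) ≤
      a ^ 2 * b ^ (s + r + 2) + a ^ (s + r + 2) * b ^ 2 := by
  have key : 0 ≤ (a ^ s - b ^ s) * (a ^ r - b ^ r) := by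
    rcases le_total a b with h | h
    · exact mul_nonneg_of_nonpos_of_nonpos (sub_nonpos.2 (pow_le_pow_left₀ ha h _))
        (sub_nonpos.2 (pow_le_pow_left₀ ha h _))
    · exact mul_nonneg (sub_nonneg.2 (pow_le_pow_left₀ hb h _))
        (sub_nonneg.2 (pow_le_pow_left₀ hb h _))
  have := mul_nonneg (mul_nonneg (sq_nonneg a) (sq_nonneg b)) key
  have e : a ^ 2 * b ^ (s + r + 2) + a ^ (s + r + 2) * b ^ 2 -
      (a ^ (s + 2) * b ^ (r + 2) + a ^ (r + 2) * b ^ (s + 2)) =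
      a ^ 2 * b ^ 2 * ((a ^ s - b ^ s) * (a ^ r - b ^ r)) := by ring
  linarith

/-- In an eigenbasis the trace is a double sum, symmetric after averaging over `i` and `j`.
`pow_mul_pow_add_le` then moves all but two of the powers onto a single eigenvalue, so that only the
return in two steps, `Q * P ^ 2 * Q`, matters. -/
theorem trace_mul_pow_mul_mul_pow_le {U : Matrix ι ι ℝ} {μ : ι → ℝ} (hU : Uᵀ * U = 1)
    (hU' : U * Uᵀ = 1) {Q : Matrix ι ι ℝ} (hQ : Q.IsSymm) (s r : ℕ) :
    (Q * (U * diagonal μ * Uᵀ) ^ (s + 2) * (Q * (U * diagonal μ * Uᵀ) ^ (r + 2))).trace ≤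
      ∑ j, |μ j| ^ (s + r + 2) * (Uᵀ * (Q * (U * diagonal μ * Uᵀ) ^ 2 * Q) * U) j j := by
  have hT : (Uᵀ * Q * U)ᵀ = Uᵀ * Q * U := by
    rw [transpose_mul, transpose_mul, transpose_transpose, hQ.eq, mul_assoc]
  have hdiag : ∀ j, (Uᵀ * (Q * (U * diagonal μ * Uᵀ) ^ 2 * Q) * U) j j =
      ∑ i, μ i ^ 2 * (Uᵀ * Q * U) i j ^ 2 := by
    intro j
    have : Uᵀ * (Q * (U * diagonal μ * Uᵀ) ^ 2 * Q) * U =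
        (Uᵀ * Q * U) * (diagonal (fun i => μ i ^ 2) * (Uᵀ * Q * U)) := by
      rw [pow_conj_diagonal hU hU']
      simp only [mul_assoc]
    rw [this, Matrix.mul_apply]
    simp only [diagonal_mul]
    refine sum_congr rfl fun i _ => ?_
    have : (Uᵀ * Q * U) j i = (Uᵀ * Q * U) i j := congrFun (congrFun hT i) j
    rw [this]
    ring
  rw [trace_mul_pow_mul_mul_pow hU hU' hQ]
  simp only [hdiag, mul_sum]
  set T := Uᵀ * Q * U
  have hTs : ∀ i j, T j i = T i j := fun i j => congrFun (congrFun hT i) j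
  have swap : ∀ f : ι → ι → ℝ, ∑ i, ∑ j, f i j = ∑ i, ∑ j, (f i j + f j i) / 2 := by
    intro f
    have : ∑ i, ∑ j, f j i = ∑ i, ∑ j, f i j := sum_comm
    simp only [← sum_div, sum_add_distrib, this]
    ring
  conv_lhs => rw [swap]
  conv_rhs => rw [swap]
  refine sum_le_sum fun i _ => sum_le_sum fun j _ => ?_
  rw [hTs i j]
  have h1 := pow_mul_pow_add_le (abs_nonneg (μ i)) (abs_nonneg (μ j)) s r
  have h2 : μ j ^ (s + 2) * μ i ^ (r + 2) ≤ |μ j| ^ (s + 2) * |μ i| ^ (r + 2) := by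
    rw [← abs_pow, ← abs_pow, ← abs_mul]; exact le_abs_self _
  have h3 : μ i ^ (s + 2) * μ j ^ (r + 2) ≤ |μ i| ^ (s + 2) * |μ j| ^ (r + 2) := by
    rw [← abs_pow, ← abs_pow, ← abs_mul]; exact le_abs_self _
  have h4 := sq_nonneg (T i j)
  rw [sq_abs, sq_abs] at h1
  nlinarith

/-- Returns in one step, in either direction round the walk, vanish by `hR`. All others reduce to
two-step returns, and `hK` is applied to each eigenvector. -/
theorem sum_trace_mul_pow_mul_mul_pow_le {P : Matrix ι ι ℝ} {U : Matrix ι ι ℝ} {μ : ι → ℝ}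
    (hU : Uᵀ * U = 1) (hU' : U * Uᵀ = 1) (hPU : P = U * diagonal μ * Uᵀ)
    {κ : Type*} [Fintype κ] (R : κ → Finset ι) {ε : ℝ} (hε : 0 ≤ ε)
    (hR : ∀ u, ∀ e ∈ R u, ∀ f ∈ R u, P e f = 0)
    (hK : ∀ v : ι → ℝ, ∑ u, ∑ e ∈ R u, ∑ f ∈ R u, (P ^ 2) e f * v e * v f ≤ ε * ∑ e, v e ^ 2)
    {s r ℓ : ℕ} (hs : 1 ≤ s) (hr : 1 ≤ r) (hsr : s + r = ℓ) :
    ∑ u, (diagonal (fun e => if e ∈ R u then (1 : ℝ) else 0) * P ^ s *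
      (diagonal (fun e => if e ∈ R u then (1 : ℝ) else 0) * P ^ r)).trace ≤
      ε * ∑ j, |μ j| ^ (ℓ - 2) := by
  have hnn : 0 ≤ ε * ∑ j, |μ j| ^ (ℓ - 2) := by positivity
  have hQPQ : ∀ u, diagonal (fun e => if e ∈ R u then (1 : ℝ) else 0) * P *
      diagonal (fun e => if e ∈ R u then (1 : ℝ) else 0) = 0 := by
    intro u
    ext e f
    rw [mul_diagonal, diagonal_mul]
    by_cases he : e ∈ R u <;> by_cases hf : f ∈ R u <;> simp [he, hf]
    exact hR u e he f hf
  rcases (show s = 1 ∨ r = 1 ∨ (2 ≤ s ∧ 2 ≤ r) by omega) with rfl | rfl | ⟨hs, hr⟩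
  · refine (le_of_eq (sum_eq_zero fun u _ => ?_)).trans hnn
    rw [pow_one, ← mul_assoc, hQPQ, zero_mul, trace_zero]
  · refine (le_of_eq (sum_eq_zero fun u _ => ?_)).trans hnn
    rw [trace_mul_comm, pow_one, ← mul_assoc, hQPQ, zero_mul, trace_zero]
  · obtain ⟨s, rfl⟩ := Nat.exists_eq_add_of_le' hs
    obtain ⟨r, rfl⟩ := Nat.exists_eq_add_of_le' hr
    have hℓ : ℓ - 2 = s + r + 2 := by omega
    rw [hℓ]
    have step : ∀ u, (diagonal (fun e => if e ∈ R u then (1 : ℝ) else 0) * P ^ (s + 2) *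
        (diagonal (fun e => if e ∈ R u then (1 : ℝ) else 0) * P ^ (r + 2))).trace ≤
        ∑ j, |μ j| ^ (s + r + 2) *
          ∑ e ∈ R u, ∑ f ∈ R u, (P ^ 2) e f * U e j * U f j := by
      intro u
      have hle := trace_mul_pow_mul_mul_pow_le hU hU'
        (Q := diagonal (fun e => if e ∈ R u then (1 : ℝ) else 0)) (μ := μ) (diagonal_transpose _) s r
      rw [← hPU] at hle
      refine hle.trans (le_of_eq (sum_congr rfl fun j _ => ?_))
      congr 1
      simp only [Matrix.mul_apply (N := U), Matrix.mul_apply (M := Uᵀ), mul_diagonal, diagonal_mul,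
        transpose_apply, sum_mul]
      have ind : ∀ g : ι → ℝ, ∑ e ∈ R u, g e = ∑ e, if e ∈ R u then g e else 0 := by
        intro g
        simp [sum_ite_mem]
      rw [sum_comm, ind]
      refine sum_congr rfl fun e _ => ?_
      rw [ind]
      split_ifs with he
      · refine sum_congr rfl fun f _ => ?_
        split_ifs <;> ring
      · exact sum_eq_zero fun f _ => by ring
    refine (sum_le_sum fun u _ => step u).trans ?_
    rw [sum_comm, mul_sum]
    refine sum_le_sum fun j _ => ?_
    rw [← mul_sum, mul_comm ε]
    refine mul_le_mul_of_nonneg_left ?_ (by positivity)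
    refine (hK fun e => U e j).trans (le_of_eq ?_)
    have h1 : (Uᵀ * U) j j = 1 := by rw [hU, one_apply_eq]
    rw [Matrix.mul_apply] at h1
    simp only [transpose_apply, ← sq] at h1
    rw [h1, mul_one]

/-- A trace argument: a nonnegative symmetric matrix whose top eigenvalue dominates its negative
ones has a closed walk of any given, sufficiently large odd length that meets each of the sets
`R u` at most once, provided few pairs of steps return to the same set. -/
theorem exists_closed_walk {P : Matrix ι ι ℝ} (hP : P.IsSymm) (hnn : ∀ e f, 0 ≤ P e f)
    {κ : Type*} [Fintype κ] (R : κ → Finset ι) {ε : ℝ} (hε : 0 ≤ ε)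
    (hlow : ∀ v : ι → ℝ, -(6 / 10) * ∑ e, v e ^ 2 ≤ ∑ e, ∑ f, P e f * v e * v f)
    (htop : ∃ v : ι → ℝ, v ≠ 0 ∧ 95 / 100 * ∑ e, v e ^ 2 ≤ ∑ e, ∑ f, P e f * v e * v f)
    (hR : ∀ u, ∀ e ∈ R u, ∀ f ∈ R u, P e f = 0)
    (hK : ∀ v : ι → ℝ, ∑ u, ∑ e ∈ R u, ∑ f ∈ R u, (P ^ 2) e f * v e * v f ≤ ε * ∑ e, v e ^ 2)
    {ℓ : ℕ} (hℓ : 2 ≤ ℓ) (hℓε : (ℓ : ℝ) ^ 2 * ε ≤ 4 / 10)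
    (hN : 4 * (Fintype.card ι : ℝ) * (9 / 10) ^ (ℓ - 2) ≤ (95 / 100) ^ ℓ) :
    ∃ w : Fin (ℓ + 1) → ι, w 0 = w (Fin.last ℓ) ∧ (∀ i : Fin ℓ, P (w i.castSucc) (w i.succ) ≠ 0) ∧
      ∀ i j : Fin ℓ, i < j → ∀ u, w i.castSucc ∈ R u → w j.castSucc ∉ R u := by
  obtain ⟨U, μ, hU, hU', hPU⟩ := exists_orthogonal_diagonalization hP
  have form : ∀ v : ι → ℝ, ∑ e, ∑ f, P e f * v e * v f = ∑ i, μ i * (Uᵀ *ᵥ v) i ^ 2 := by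
    intro v
    have h1 : ∑ e, ∑ f, P e f * v e * v f = v ⬝ᵥ P *ᵥ v := by
      simp only [dotProduct, mulVec, mul_sum]
      exact sum_congr rfl fun e _ => sum_congr rfl fun f _ => by ring
    rw [h1, hPU, ← mulVec_mulVec, ← mulVec_mulVec, dotProduct_mulVec, ← mulVec_transpose]
    simp only [dotProduct, mulVec_diagonal]
    exact sum_congr rfl fun i _ => by ring
  have hnorm : ∀ v : ι → ℝ, ∑ e, v e ^ 2 = ∑ i, (Uᵀ *ᵥ v) i ^ 2 := by
    intro v
    have h1 : v ⬝ᵥ v = (Uᵀ *ᵥ v) ⬝ᵥ (Uᵀ *ᵥ v) := by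
      rw [mulVec_transpose, ← dotProduct_mulVec, ← mulVec_transpose, mulVec_mulVec, hU',
        one_mulVec]
    simpa only [dotProduct, ← sq] using h1
  have hμ : ∀ i, -(6 / 10) ≤ μ i := by
    intro i
    have := hlow (U *ᵥ Pi.single i 1)
    rw [form, hnorm, mulVec_mulVec, hU, one_mulVec] at this
    simpa [Pi.single_apply] using this
  obtain ⟨i₀, hi₀⟩ : ∃ i, 95 / 100 ≤ μ i := by
    by_contra! hcon
    obtain ⟨v, hv, hle⟩ := htop
    rw [form, hnorm, mul_sum] at hle
    have hne : Uᵀ *ᵥ v ≠ 0 := by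
      intro h0
      apply hv
      rw [← one_mulVec v, ← hU', ← mulVec_mulVec, h0, mulVec_zero]
    obtain ⟨j, hj⟩ := Function.ne_iff.1 hne
    refine absurd hle (not_le.2 (sum_lt_sum (fun i _ => ?_) ⟨j, mem_univ _, ?_⟩))
    · exact mul_le_mul_of_nonneg_right (hcon i).le (sq_nonneg _)
    · exact mul_lt_mul_of_pos_right (hcon j) (sq_pos_of_ne_zero hj)
  by_contra! hcon
  let Q : κ → Matrix ι ι ℝ := fun u => diagonal (fun e => if e ∈ R u then (1 : ℝ) else 0)
  have hQ : ∀ u a b, (Q u * P) a b = if a ∈ R u then P a b else 0 := by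
    intro u a b
    simp [Q, diagonal_mul]
  let A : ℕ → ℕ → κ → ℕ → Matrix ι ι ℝ := fun i j u t => if t = i ∨ t = j then Q u * P else P
  have hA : ∀ i j u t a b, 0 ≤ A i j u t a b := by
    intro i j u t a b
    simp only [A]
    split_ifs
    · rw [hQ]; split_ifs <;> simp [hnn]
    · exact hnn a b
  -- Union bound: by `hcon`, each closed walk of nonzero weight lies in some `R u` at two times `i <
  -- j`, hence is counted with its full weight on the right.
  have expand : (P ^ ℓ).trace ≤ ∑ i : Fin ℓ, ∑ j : Fin ℓ, if i < j then
      ∑ u, ((List.range ℓ).map (A i j u)).prod.trace else 0 := by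
    have hpow : P ^ ℓ = ((List.range ℓ).map fun _ => P).prod := by simp
    rw [hpow, trace_prod_range_map]
    simp only [trace_prod_range_map]
    have swap : ∀ i j : Fin ℓ, (if i < j then ∑ u, ∑ w : Fin (ℓ + 1) → ι,
        (if w 0 = w (Fin.last ℓ) then ∏ t : Fin ℓ, A i j u t (w t.castSucc) (w t.succ) else 0)
        else 0) = ∑ w : Fin (ℓ + 1) → ι, if i < j then ∑ u,
        (if w 0 = w (Fin.last ℓ) then ∏ t : Fin ℓ, A i j u t (w t.castSucc) (w t.succ) else 0)
        else 0 := by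
      intro i j
      split_ifs
      · exact sum_comm
      · simp
    simp only [swap]
    simp only [sum_comm (t := (univ : Finset (Fin (ℓ + 1) → ι)))]
    refine sum_le_sum fun w _ => ?_
    have nn : ∀ i j u, 0 ≤ if w 0 = w (Fin.last ℓ) then
        ∏ t : Fin ℓ, A i j u t (w t.castSucc) (w t.succ) else 0 := by
      intro i j u
      split_ifs
      · exact prod_nonneg fun t _ => hA _ _ _ _ _ _
      · exact le_rfl
    have nn2 : ∀ i j : Fin ℓ, 0 ≤ if i < j then ∑ u, (if w 0 = w (Fin.last ℓ) then
        ∏ t : Fin ℓ, A i j u t (w t.castSucc) (w t.succ) else 0) else 0 := by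
      intro i j
      split_ifs
      · exact sum_nonneg fun u _ => by have := nn i j u; simpa [*] using this
      · simp
      · simp
    by_cases hw : w 0 = w (Fin.last ℓ)
    · rw [if_pos hw]
      by_cases hz : ∀ i : Fin ℓ, P (w i.castSucc) (w i.succ) ≠ 0
      · obtain ⟨i, j, hij, u, hi, hj⟩ := hcon w hw hz
        refine le_trans ?_ (single_le_sum (fun i _ => sum_nonneg fun j _ => nn2 i j) (mem_univ i))
        refine le_trans ?_ (single_le_sum (fun j _ => nn2 i j) (mem_univ j))
        rw [if_pos hij]
        refine le_trans (le_of_eq ?_) (single_le_sum (fun u _ => nn i j u) (mem_univ u))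
        rw [if_pos hw]
        refine prod_congr rfl fun t _ => ?_
        simp only [A]
        split_ifs with ht
        · rw [hQ, if_pos]
          rcases ht with ht | ht
          · rwa [Fin.ext ht]
          · rwa [Fin.ext ht]
        · rfl
      · push Not at hz
        obtain ⟨t, ht⟩ := hz
        rw [prod_eq_zero (mem_univ t) ht]
        exact sum_nonneg fun i _ => sum_nonneg fun j _ => nn2 i j
    · rw [if_neg hw]
      exact sum_nonneg fun i _ => sum_nonneg fun j _ => nn2 i j
  have pair : ∀ i j : Fin ℓ, (if i < j then
      ∑ u, ((List.range ℓ).map (A i j u)).prod.trace else 0) ≤ ε * ∑ k, |μ k| ^ (ℓ - 2) := by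
    intro i j
    split_ifs with hij
    · have hi := i.isLt
      have hj := j.isLt
      have hij' : (i : ℕ) < j := hij
      have := sum_trace_mul_pow_mul_mul_pow_le hU hU' hPU R hε hR hK (s := j - i)
        (r := ℓ - (j - i)) (ℓ := ℓ) (by omega) (by omega) (by omega)
      refine (le_of_eq (sum_congr rfl fun u _ => ?_)).trans this
      rw [prod_range_map_insert P (Q u) hij' hj, mul_assoc, trace_mul_comm, mul_assoc, mul_assoc,
        mul_assoc (Q u), ← pow_add, show ℓ - (j : ℕ) + i = ℓ - (j - i) by omega, ← mul_assoc]
    · positivity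
  have htr : (P ^ ℓ).trace = ∑ i, μ i ^ ℓ := by
    rw [hPU, trace_pow_conj_diagonal hU hU']
  have hfin := sum_pow_sub_pos hμ hi₀ (c := (ℓ : ℝ) ^ 2 * ε) (by positivity) hℓε hℓ hN
  have : (P ^ ℓ).trace ≤ (ℓ : ℝ) ^ 2 * ε * ∑ k, |μ k| ^ (ℓ - 2) := by
    refine expand.trans ((sum_le_sum fun i _ => sum_le_sum fun j _ => pair i j).trans ?_)
    simp only [sum_const, card_univ, Fintype.card_fin, nsmul_eq_mul]
    apply le_of_eq
    ring
  linarith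

end Spectral

/-! ### Passing from weights to the normalised matrix. -/

section WeightedWalk

open Matrix Finset

variable {ι : Type*} [Fintype ι] [DecidableEq ι]

/-- A Schur test with weights `s`: the first step has total weight at most one, the second enters `R
u` with weight at most `δ`. The factor `2` is the number of sets `R u` containing a given index. -/
theorem sum_return_le {κ : Type*} [Fintype κ] (R : κ → Finset ι) {m : ι → ι → ℝ} {s : ι → ℝ}
    (hm : ∀ e f, m e f = m f e) (hnn : ∀ e f, 0 ≤ m e f) (hs : ∀ e, 0 < s e) {δ : ℝ} (hδ : 0 ≤ δ)
    (hdeg : ∀ e, ∑ f, m e f ≤ s e ^ 2) (hhit : ∀ u g, ∑ f ∈ R u, m g f ≤ δ * s g ^ 2)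
    (hcard : ∀ e, ∑ u, (if e ∈ R u then (1 : ℝ) else 0) ≤ 2) (v : ι → ℝ) :
    ∑ u, ∑ e ∈ R u, ∑ f ∈ R u, ((Matrix.of fun e f => m e f / (s e * s f)) ^ 2) e f * v e * v f ≤
      2 * δ * ∑ e, v e ^ 2 := by
  set P : Matrix ι ι ℝ := Matrix.of fun e f => m e f / (s e * s f) with hPdef
  have hPnn : ∀ e f, 0 ≤ (P ^ 2) e f := by
    intro e f
    rw [pow_two, Matrix.mul_apply]
    exact sum_nonneg fun g _ => mul_nonneg
      (div_nonneg (hnn _ _) (mul_pos (hs _) (hs _)).le)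
      (div_nonneg (hnn _ _) (mul_pos (hs _) (hs _)).le)
  have hPs : ∀ e f, (P ^ 2) e f = (P ^ 2) f e := by
    intro e f
    rw [pow_two, Matrix.mul_apply, Matrix.mul_apply]
    refine sum_congr rfl fun g _ => ?_
    simp only [hPdef, Matrix.of_apply]
    rw [hm e g, hm g f, mul_comm (s e), mul_comm (s g)]
    ring
  have hrow : ∀ u e, ∑ f ∈ R u, (P ^ 2) e f * s f ≤ δ * s e := by
    intro u e
    have hse := hs e
    have h1 : ∑ f ∈ R u, (P ^ 2) e f * s f =
        ∑ g, m e g / (s e * s g ^ 2) * ∑ f ∈ R u, m g f := by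
      simp only [pow_two P, Matrix.mul_apply, sum_mul, mul_sum]
      rw [sum_comm]
      refine sum_congr rfl fun g _ => sum_congr rfl fun f _ => ?_
      simp only [hPdef, Matrix.of_apply]
      have := (hs g).ne'
      have := (hs f).ne'
      field_simp
    rw [h1]
    calc ∑ g, m e g / (s e * s g ^ 2) * ∑ f ∈ R u, m g f
        ≤ ∑ g, m e g / (s e * s g ^ 2) * (δ * s g ^ 2) := by
          refine sum_le_sum fun g _ => mul_le_mul_of_nonneg_left (hhit u g) ?_
          exact div_nonneg (hnn _ _) (mul_pos hse (pow_pos (hs g) 2)).le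
      _ = δ / s e * ∑ g, m e g := by
          rw [mul_sum]
          refine sum_congr rfl fun g _ => ?_
          have := (hs g).ne'
          field_simp
      _ ≤ δ / s e * s e ^ 2 := mul_le_mul_of_nonneg_left (hdeg e) (by positivity)
      _ = δ * s e := by field_simp
  have hpt : ∀ e f, (P ^ 2) e f * v e * v f ≤
      ((P ^ 2) e f * s f * (v e ^ 2 / s e) + (P ^ 2) f e * s e * (v f ^ 2 / s f)) / 2 := by
    intro e f
    have he := hs e
    have hf := hs f
    rw [← hPs e f]
    have key : v e * v f ≤ (s f * (v e ^ 2 / s e) + s e * (v f ^ 2 / s f)) / 2 := by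
      have : (s f * (v e ^ 2 / s e) + s e * (v f ^ 2 / s f)) / 2 - v e * v f =
          (s f * v e - s e * v f) ^ 2 / (2 * s e * s f) := by
        field_simp
        ring
      have h2 : 0 ≤ (s f * v e - s e * v f) ^ 2 / (2 * s e * s f) := by positivity
      linarith
    have := mul_le_mul_of_nonneg_left key (hPnn e f)
    linarith
  have hu : ∀ u, ∑ e ∈ R u, ∑ f ∈ R u, (P ^ 2) e f * v e * v f ≤
      ∑ e ∈ R u, δ * v e ^ 2 := by
    intro u
    calc ∑ e ∈ R u, ∑ f ∈ R u, (P ^ 2) e f * v e * v f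
        ≤ ∑ e ∈ R u, ∑ f ∈ R u, ((P ^ 2) e f * s f * (v e ^ 2 / s e) +
            (P ^ 2) f e * s e * (v f ^ 2 / s f)) / 2 :=
          sum_le_sum fun e _ => sum_le_sum fun f _ => hpt e f
      _ = ∑ e ∈ R u, ∑ f ∈ R u, (P ^ 2) e f * s f * (v e ^ 2 / s e) := by
          simp only [← sum_div, sum_add_distrib]
          rw [sum_comm (f := fun e f => (P ^ 2) f e * s e * (v f ^ 2 / s f))]
          ring
      _ ≤ ∑ e ∈ R u, δ * v e ^ 2 := by
          refine sum_le_sum fun e _ => ?_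
          rw [← sum_mul]
          have he := hs e
          calc (∑ f ∈ R u, (P ^ 2) e f * s f) * (v e ^ 2 / s e) ≤ δ * s e * (v e ^ 2 / s e) :=
                mul_le_mul_of_nonneg_right (hrow u e) (by positivity)
            _ = δ * v e ^ 2 := by field_simp
  refine (sum_le_sum fun u _ => hu u).trans ?_
  have ind : ∀ u, ∑ e ∈ R u, δ * v e ^ 2 =
      ∑ e, (if e ∈ R u then (1 : ℝ) else 0) * (δ * v e ^ 2) := by
    intro u
    simp [sum_ite_mem]
  simp only [ind]
  rw [sum_comm, mul_sum]
  refine sum_le_sum fun e _ => ?_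
  rw [← sum_mul]
  have : 0 ≤ δ * v e ^ 2 := by positivity
  nlinarith [hcard e]

/-- The substitution `v e = s e * F e` turns the quadratic form of `m`, relative to the weights `s ^
2`, into that of a symmetric matrix relative to the Euclidean norm. -/
theorem exists_closed_walk_of_weights {κ : Type*} [Fintype κ] (R : κ → Finset ι)
    {m : ι → ι → ℝ} {s : ι → ℝ}
    (hm : ∀ e f, m e f = m f e) (hnn : ∀ e f, 0 ≤ m e f) (hs : ∀ e, 0 < s e) {δ : ℝ} (hδ : 0 ≤ δ)
    (hlow : ∀ F : ι → ℝ, -(6 / 10) * ∑ e, s e ^ 2 * F e ^ 2 ≤ ∑ e, ∑ f, m e f * F e * F f)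
    (htop : ∃ F : ι → ℝ, F ≠ 0 ∧
      95 / 100 * ∑ e, s e ^ 2 * F e ^ 2 ≤ ∑ e, ∑ f, m e f * F e * F f)
    (hdeg : ∀ e, ∑ f, m e f ≤ s e ^ 2) (hhit : ∀ u g, ∑ f ∈ R u, m g f ≤ δ * s g ^ 2)
    (hcard : ∀ e, ∑ u, (if e ∈ R u then (1 : ℝ) else 0) ≤ 2)
    (hR : ∀ u, ∀ e ∈ R u, ∀ f ∈ R u, m e f = 0)
    {ℓ : ℕ} (hℓ : 2 ≤ ℓ) (hℓδ : (ℓ : ℝ) ^ 2 * (2 * δ) ≤ 4 / 10)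
    (hN : 4 * (Fintype.card ι : ℝ) * (9 / 10) ^ (ℓ - 2) ≤ (95 / 100) ^ ℓ) :
    ∃ w : Fin (ℓ + 1) → ι, w 0 = w (Fin.last ℓ) ∧ (∀ i : Fin ℓ, m (w i.castSucc) (w i.succ) ≠ 0) ∧
      ∀ i j : Fin ℓ, i < j → ∀ u, w i.castSucc ∈ R u → w j.castSucc ∉ R u := by
  set P : Matrix ι ι ℝ := Matrix.of fun e f => m e f / (s e * s f) with hPdef
  have hform : ∀ v : ι → ℝ, ∑ e, ∑ f, P e f * v e * v f =
      ∑ e, ∑ f, m e f * (v e / s e) * (v f / s f) := by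
    intro v
    refine sum_congr rfl fun e _ => sum_congr rfl fun f _ => ?_
    have := (hs e).ne'
    have := (hs f).ne'
    simp only [hPdef, Matrix.of_apply]
    field_simp
  have hnorm : ∀ v : ι → ℝ, ∑ e, v e ^ 2 = ∑ e, s e ^ 2 * (v e / s e) ^ 2 := by
    intro v
    refine sum_congr rfl fun e _ => ?_
    have := (hs e).ne'
    field_simp
  obtain ⟨w, hw, hstep, hdisj⟩ := exists_closed_walk (P := P) (R := R) (ε := 2 * δ)
    (by
      ext e f
      simp only [hPdef, Matrix.transpose_apply, Matrix.of_apply]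
      rw [hm, mul_comm (s e)])
    (fun e f => div_nonneg (hnn _ _) (mul_pos (hs _) (hs _)).le) (by positivity)
    (fun v => by rw [hform, hnorm]; exact hlow _)
    (by
      obtain ⟨F, hF, hle⟩ := htop
      refine ⟨fun e => s e * F e, ?_, ?_⟩
      · obtain ⟨e, he⟩ := Function.ne_iff.1 hF
        exact Function.ne_iff.2 ⟨e, mul_ne_zero (hs e).ne' he⟩
      · rw [hform, hnorm]
        have : (fun e => s e * F e / s e) = F := by
          funext e
          rw [mul_div_cancel_left₀ _ (hs e).ne']
        have h2 : ∀ e, s e * F e / s e = F e := congrFun this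
        simpa only [h2] using hle)
    (fun u e he f hf => by simp [hPdef, hR u e he f hf])
    (sum_return_le R hm hnn hs hδ hdeg hhit hcard) hℓ hℓδ hN
  refine ⟨w, hw, fun i h0 => hstep i ?_, hdisj⟩
  simp [hPdef, h0]

end WeightedWalk

/-! ### Quadratic forms of four-cycles and large codegrees. -/

section FourCycleForms

open Finset

variable {V : Type*} [Fintype V]

/-- The quadratic form on functions of ordered edges that pairs opposite edges of four-cycles. -/
theorem four_cycle_form_lower_bound {A : V → V → ℝ} (hA : ∀ x y, 0 ≤ A x y) (F : V → V → ℝ) :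
    0 ≤ 2 * ∑ x, ∑ y, ∑ x', ∑ y', A x y * A x' y * A x' y' * A x y' * (F x y * F x' y') +
      ∑ x, ∑ y, ∑ x', ∑ y', A x y * A x' y * A x' y' * A x y' * F x y ^ 2 := by
  set W : V → V → V → V → ℝ := fun x y x' y' => A x y * A x' y * A x' y' * A x y' with hW
  let S : (V → V → V → V → ℝ) → ℝ := fun g => ∑ x, ∑ y, ∑ x', ∑ y', g x y x' y'
  have swapy : ∀ g : V → V → V → V → ℝ, S g = S fun x y x' y' => g x y' x' y := by
    intro g
    refine sum_congr rfl fun x _ => ?_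
    calc ∑ y, ∑ x', ∑ y', g x y x' y' = ∑ x', ∑ y, ∑ y', g x y x' y' := sum_comm
      _ = ∑ x', ∑ y', ∑ y, g x y x' y' := sum_congr rfl fun x' _ => sum_comm
      _ = _ := sum_comm
  have swapx : ∀ g : V → V → V → V → ℝ, S g = S fun x y x' y' => g x' y x y' := by
    intro g
    calc ∑ x, ∑ y, ∑ x', ∑ y', g x y x' y' = ∑ y, ∑ x, ∑ x', ∑ y', g x y x' y' := sum_comm
      _ = ∑ y, ∑ x', ∑ x, ∑ y', g x y x' y' := sum_congr rfl fun x' _ => sum_comm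
      _ = _ := sum_comm
  have hadd : ∀ g h : V → V → V → V → ℝ, (S fun x y x' y' => g x y x' y' + h x y x' y') =
      S g + S h := by
    intro g h
    simp only [S, sum_add_distrib]
  have hsmul : ∀ (c : ℝ) (g : V → V → V → V → ℝ), (S fun x y x' y' => c * g x y x' y') =
      c * S g := by
    intro c g
    simp only [S, mul_sum]
  set I := S fun x y x' y' => W x y x' y' * F x y ^ 2 with hI
  set m := S fun x y x' y' => W x y x' y' * (F x y * F x' y') with hm
  set α := S fun x y x' y' => W x y x' y' * (F x y * F x y') with hα
  set β := S fun x y x' y' => W x y x' y' * (F x y' * F x' y') with hβ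
  have hI2 : (S fun x y x' y' => W x y x' y' * F x y' ^ 2) = I := by
    rw [swapy]
    simp only [hI, S, hW]
    refine sum_congr rfl fun x _ => sum_congr rfl fun y _ => sum_congr rfl fun x' _ =>
      sum_congr rfl fun y' _ => by ring
  have hI3 : (S fun x y x' y' => W x y x' y' * F x' y' ^ 2) = I := by
    rw [swapx, ← hI2]
    refine sum_congr rfl fun x _ => sum_congr rfl fun y _ => sum_congr rfl fun x' _ =>
      sum_congr rfl fun y' _ => by simp only [hW]; ring
  -- Here `m` pairs opposite edges of a four-cycle, while `α` and `β` pair consecutive ones. The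
  -- square combines two opposite edges with one between them. Together with `α + m ≥ 0` and `β + m
  -- ≥ 0`, which hold because these sums are squares for a fixed diagonal, it gives `3 * (I + 2 * m)
  -- ≥ 0`.
  have hsq : 0 ≤ 3 * I + 2 * m - 2 * α - 2 * β := by
    have h0 : 0 ≤ S fun x y x' y' => W x y x' y' * (F x y + F x' y' - F x y') ^ 2 := by
      refine sum_nonneg fun x _ => sum_nonneg fun y _ => sum_nonneg fun x' _ =>
        sum_nonneg fun y' _ => ?_
      have h1 := hA x y
      have h2 := hA x' y
      have h3 := hA x' y'
      have h4 := hA x y'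
      positivity
    have h1 : (S fun x y x' y' => W x y x' y' * (F x y + F x' y' - F x y') ^ 2) =
        I + (S fun x y x' y' => W x y x' y' * F x' y' ^ 2) +
        (S fun x y x' y' => W x y x' y' * F x y' ^ 2) + 2 * m + (-2) * α + (-2) * β := by
      rw [hI, hm, hα, hβ]
      simp only [← hsmul, ← hadd]
      refine sum_congr rfl fun x _ => sum_congr rfl fun y _ => sum_congr rfl fun x' _ =>
        sum_congr rfl fun y' _ => by ring
    rw [h1, hI2, hI3] at h0
    linarith
  have hαm : 0 ≤ 2 * α + 2 * m := by
    have h0 : 0 ≤ ∑ x, ∑ x', ((∑ y, A x y * A x' y * F x y) + ∑ y, A x y * A x' y * F x' y) ^ 2 :=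
      sum_nonneg fun x _ => sum_nonneg fun x' _ => sq_nonneg _
    have hα2 : (S fun x y x' y' => W x y x' y' * (F x' y * F x' y')) = α := by
      rw [swapx]
      refine sum_congr rfl fun x _ => sum_congr rfl fun y _ => sum_congr rfl fun x' _ =>
        sum_congr rfl fun y' _ => by simp only [hW]; ring
    have h1 : ∑ x, ∑ x', ((∑ y, A x y * A x' y * F x y) + ∑ y, A x y * A x' y * F x' y) ^ 2 =
        α + (S fun x y x' y' => W x y x' y' * (F x' y * F x' y')) + 2 * m := by
      rw [hα, hm]
      simp only [← hsmul, ← hadd, S]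
      refine sum_congr rfl fun x _ => ?_
      rw [sum_comm]
      refine sum_congr rfl fun x' _ => ?_
      have e1 : ∀ f g : V → ℝ, (∑ y, f y + ∑ y, g y) ^ 2 =
          ∑ y, ∑ y', (f y * f y' + g y * g y' + 2 * (f y * g y')) := by
        intro f g
        simp only [sum_add_distrib, ← mul_sum, ← sum_mul]
        ring
      rw [e1]
      refine sum_congr rfl fun y _ => sum_congr rfl fun y' _ => ?_
      simp only [hW]
      ring
    rw [h1, hα2] at h0
    linarith
  have hβm : 0 ≤ 2 * β + 2 * m := by
    have h0 : 0 ≤ ∑ y, ∑ y', ((∑ x, A x y * A x y' * F x y) + ∑ x, A x y * A x y' * F x y') ^ 2 :=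
      sum_nonneg fun x _ => sum_nonneg fun x' _ => sq_nonneg _
    have hβ2 : (S fun x y x' y' => W x y x' y' * (F x y * F x' y)) = β := by
      rw [swapy]
      refine sum_congr rfl fun x _ => sum_congr rfl fun y _ => sum_congr rfl fun x' _ =>
        sum_congr rfl fun y' _ => by simp only [hW]; ring
    have h1 : ∑ y, ∑ y', ((∑ x, A x y * A x y' * F x y) + ∑ x, A x y * A x y' * F x y') ^ 2 =
        (S fun x y x' y' => W x y x' y' * (F x y * F x' y)) + β + 2 * m := by
      rw [hβ, hm]
      simp only [← hsmul, ← hadd, S]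
      rw [sum_comm (s := (univ : Finset V)) (f := fun x y => ∑ x', ∑ y', _)]
      refine sum_congr rfl fun y _ => ?_
      have e1 : ∀ f g : V → ℝ, (∑ y, f y + ∑ y, g y) ^ 2 =
          ∑ y, ∑ y', (f y * f y' + g y * g y' + 2 * (f y * g y')) := by
        intro f g
        simp only [sum_add_distrib, ← mul_sum, ← sum_mul]
        ring
      simp only [e1]
      rw [sum_comm]
      refine sum_congr rfl fun x _ => ?_
      rw [sum_comm]
      refine sum_congr rfl fun x' _ => sum_congr rfl fun y' _ => ?_
      simp only [hW]
      ring
    rw [h1, hβ2] at h0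
    linarith
  change 0 ≤ 2 * m + I
  linarith

/-- If the common neighbourhoods of `a` with the members of `T` are large but pairwise almost
disjoint, their sizes sum to at most twice the degree of `a`. -/
theorem sum_codegree_le {A : V → V → ℝ} (h01 : ∀ x y, A x y ^ 2 = A x y) {a : V} {T : Finset V}
    {τ : ℝ} (hτ : 0 < τ) (hd : 4 * ∑ y, A a y ≤ τ ^ 2) (hT : ∀ b ∈ T, τ ≤ ∑ y, A a y * A b y)
    (hK : ∀ b ∈ T, ∀ c ∈ T, b ≠ c → ∑ y, A a y * A b y * A c y ≤ 2) :
    ∑ b ∈ T, ∑ y, A a y * A b y ≤ 2 * ∑ y, A a y := by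
  classical
  set s := ∑ b ∈ T, ∑ y, A a y * A b y with hs
  set d := ∑ y, A a y with hd'
  set h : ℝ := (T.card : ℝ) with hh
  have hA : ∀ x y, 0 ≤ A x y := fun x y => by rw [← h01]; positivity
  have hd0 : 0 ≤ d := sum_nonneg fun y _ => hA a y
  have hhs : h * τ ≤ s := by
    rw [hh, ← nsmul_eq_mul]
    exact card_nsmul_le_sum _ _ _ hT
  have hs0 : 0 ≤ s := sum_nonneg fun b _ => sum_nonneg fun y _ => mul_nonneg (hA _ _) (hA _ _)
  -- Cauchy–Schwarz over the neighbours of `a`; the off-diagonal pairs in `T` contribute at most `2`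
  -- each.
  have hcs : s ^ 2 ≤ d * (s + 2 * h ^ 2) := by
    have e1 : s = ∑ y, A a y * ∑ b ∈ T, A a y * A b y := by
      rw [hs, sum_comm]
      refine sum_congr rfl fun y _ => ?_
      rw [mul_sum]
      refine sum_congr rfl fun b _ => ?_
      rw [← mul_assoc, ← sq, h01]
    have e2 : s ^ 2 ≤ (∑ y, A a y ^ 2) * ∑ y, (∑ b ∈ T, A a y * A b y) ^ 2 := by
      rw [e1]
      exact sum_mul_sq_le_sq_mul_sq _ _ _
    have e3 : ∑ y, (∑ b ∈ T, A a y * A b y) ^ 2 ≤ s + 2 * h ^ 2 := by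
      have e4 : ∑ y, (∑ b ∈ T, A a y * A b y) ^ 2 =
          ∑ b ∈ T, ∑ c ∈ T, ∑ y, A a y * A b y * A c y := by
        simp only [sq, sum_mul_sum]
        rw [sum_comm]
        refine sum_congr rfl fun b _ => ?_
        rw [sum_comm]
        refine sum_congr rfl fun c _ => sum_congr rfl fun y _ => ?_
        calc A a y * A b y * (A a y * A c y) = A a y ^ 2 * A b y * A c y := by ring
          _ = _ := by rw [h01]
      rw [e4]
      calc ∑ b ∈ T, ∑ c ∈ T, ∑ y, A a y * A b y * A c y
          ≤ ∑ b ∈ T, ∑ c ∈ T, ((if b = c then ∑ y, A a y * A b y else 0) + 2) := by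
            refine sum_le_sum fun b hb => sum_le_sum fun c hc => ?_
            split_ifs with hbc
            · subst hbc
              have : ∑ y, A a y * A b y * A b y = ∑ y, A a y * A b y :=
                sum_congr rfl fun y _ => by rw [mul_assoc, ← sq, h01]
              linarith
            · linarith [hK b hb c hc hbc]
        _ = s + 2 * h ^ 2 := by
            simp only [sum_add_distrib, sum_const, nsmul_eq_mul]
            simp [hs, hh]
            ring
    simp only [h01] at e2
    exact e2.trans (mul_le_mul_of_nonneg_left e3 hd0)
  have h1 : 0 ≤ h := by positivity
  -- Hence the term `2 * d * h ^ 2` above is at most `s ^ 2 / 2`, and `s ≤ 2 * d` follows.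
  have h2 : 4 * d * h ^ 2 ≤ s ^ 2 := by
    have : (h * τ) ^ 2 ≤ s ^ 2 := pow_le_pow_left₀ (by positivity) hhs 2
    nlinarith [sq_nonneg h]
  by_contra hcon
  push Not at hcon
  nlinarith

end FourCycleForms

/-! ### Light four-cycles and the disjoint closed walk. -/

section LightWalk

open Finset

variable {V : Type*} [Fintype V]

open Classical in
/-- Indicator of pairs of distinct vertices of codegree less than `τ`. -/
noncomputable def lightPair (A : V → V → ℝ) (τ : ℝ) (x x' : V) : ℝ :=
  if x ≠ x' ∧ ∑ y, A x y * A x' y < τ then 1 else 0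

variable {A : V → V → ℝ} {τ : ℝ}

theorem lightPair_comm (x x' : V) : lightPair A τ x x' = lightPair A τ x' x := by
  have : ∑ y, A x y * A x' y = ∑ y, A x' y * A x y := sum_congr rfl fun y _ => mul_comm _ _
  have h : (x ≠ x' ∧ ∑ y, A x y * A x' y < τ) ↔ (x' ≠ x ∧ ∑ y, A x' y * A x y < τ) := by
    rw [this, ne_comm]
  by_cases h' : x' ≠ x ∧ ∑ y, A x' y * A x y < τ
  · rw [lightPair, lightPair, if_pos h', if_pos (h.2 h')]
  · rw [lightPair, lightPair, if_neg h', if_neg (mt h.1 h')]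

theorem lightPair_nonneg (x x' : V) : 0 ≤ lightPair A τ x x' := by
  rw [lightPair]; split_ifs <;> norm_num

theorem lightPair_le_one (x x' : V) : lightPair A τ x x' ≤ 1 := by
  rw [lightPair]; split_ifs <;> norm_num

theorem lightPair_self (x : V) : lightPair A τ x x = 0 := by
  simp [lightPair]

theorem lightPair_mul_codegree_le (hτ : 0 < τ) (x x' : V) :
    lightPair A τ x x' * ∑ y, A x y * A x' y ≤ τ := by
  rw [lightPair]
  split_ifs with h
  · rw [one_mul]; exact h.2.le
  · rw [zero_mul]; exact hτ.le

/-- The vertex `a` itself is not light and accounts for one degree; the vertices of large codegree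
account for two, by `sum_codegree_le`. -/
theorem sum_one_sub_lightPair_mul_codegree_le (h01 : ∀ x y, A x y ^ 2 = A x y) (hτ : 0 < τ)
    {a : V} (hd : 4 * ∑ y, A a y ≤ τ ^ 2)
    (hK : ∀ b c, a ≠ b → a ≠ c → b ≠ c → ∑ y, A a y * A b y * A c y ≤ 2) :
    ∑ b, (1 - lightPair A τ a b) * ∑ y, A a y * A b y ≤ 3 * ∑ y, A a y := by
  classical
  have hA : ∀ x y, 0 ≤ A x y := fun x y => by rw [← h01]; positivity
  set T : Finset V := univ.filter fun b => a ≠ b ∧ τ ≤ ∑ y, A a y * A b y with hTdef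
  have hT := sum_codegree_le h01 hτ hd (T := T) (fun b hb => (mem_filter.1 hb).2.2)
    (fun b hb c hc hbc => hK b c (mem_filter.1 hb).2.1 (mem_filter.1 hc).2.1 hbc)
  have hpt : ∀ b, (1 - lightPair A τ a b) * ∑ y, A a y * A b y ≤
      (if a = b then ∑ y, A a y else 0) +
        if b ∈ T then ∑ y, A a y * A b y else 0 := by
    intro b
    have hc : 0 ≤ ∑ y, A a y * A b y := sum_nonneg fun y _ => mul_nonneg (hA _ _) (hA _ _)
    by_cases hab : a = b
    · subst hab
      simp [lightPair_self, T, ← sq, h01]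
    · by_cases hlt : ∑ y, A a y * A b y < τ
      · simp [lightPair, T, hab, hlt, not_le.2 hlt]
      · simp [lightPair, T, hab, hlt, not_lt.1 hlt]
  refine (sum_le_sum fun b _ => hpt b).trans ?_
  rw [sum_add_distrib, sum_ite_eq, if_pos (mem_univ _), sum_ite_mem, univ_inter]
  linarith

/-- The steps between opposite edges of a four-cycle both of whose diagonals are light. -/
noncomputable def lightStep (A : V → V → ℝ) (τ : ℝ) (e f : V × V) : ℝ :=
  A e.1 e.2 * A f.1 e.2 * A f.1 f.2 * A e.1 f.2 * (lightPair A τ e.1 f.1 * lightPair A τ e.2 f.2)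

theorem lightStep_comm (e f : V × V) :
    lightStep A τ e f = lightStep A τ f e := by
  rw [lightStep, lightStep, lightPair_comm e.1, lightPair_comm e.2]
  ring

theorem lightStep_nonneg (hA : ∀ x y, 0 ≤ A x y) (e f : V × V) : 0 ≤ lightStep A τ e f := by
  have h1 := hA e.1 e.2
  have h2 := hA f.1 e.2
  have h3 := hA f.1 f.2
  have h4 := hA e.1 f.2
  have h5 := lightPair_nonneg (A := A) (τ := τ) e.1 f.1
  have h6 := lightPair_nonneg (A := A) (τ := τ) e.2 f.2
  rw [lightStep]
  positivity

/-- The number of four-cycles through an edge one of whose diagonals is not light. -/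
theorem sum_not_lightStep_le (h01 : ∀ x y, A x y ^ 2 = A x y) (hs : ∀ x y, A x y = A y x)
    (hτ : 0 < τ) (hd : ∀ a, 4 * ∑ y, A a y ≤ τ ^ 2)
    (hK : ∀ a b c, a ≠ b → a ≠ c → b ≠ c → ∑ y, A a y * A b y * A c y ≤ 2) (e : V × V) :
    ∑ f : V × V, (A e.1 e.2 * A f.1 e.2 * A f.1 f.2 * A e.1 f.2 - lightStep A τ e f) ≤
      3 * A e.1 e.2 * (∑ y, A e.1 y + ∑ x, A e.2 x) := by
  obtain ⟨x, y⟩ := e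
  have hA : ∀ x y, 0 ≤ A x y := fun x y => by rw [← h01]; positivity
  have hA1 : ∀ x y, A x y ≤ 1 := fun x y => by nlinarith [h01 x y, hA x y]
  rw [Fintype.sum_prod_type]
  simp only [lightStep]
  -- Union bound over the two diagonals, dropping one edge of the four-cycle in each case.
  have hpt : ∀ x' y', A x y * A x' y * A x' y' * A x y' -
      A x y * A x' y * A x' y' * A x y' * (lightPair A τ x x' * lightPair A τ y y') ≤
      A x y * ((1 - lightPair A τ x x') * (A x y' * A x' y')) +
      A x y * ((1 - lightPair A τ y y') * (A y x' * A y' x')) := by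
    intro x' y'
    have l1 := lightPair_nonneg (A := A) (τ := τ) x x'
    have l2 := lightPair_le_one (A := A) (τ := τ) x x'
    have l3 := lightPair_nonneg (A := A) (τ := τ) y y'
    have l4 := lightPair_le_one (A := A) (τ := τ) y y'
    rw [hs y x', hs y' x']
    have p1 : A x' y * A x' y' * A x y' ≤ A x y' * A x' y' := by
      nlinarith [mul_nonneg (hA x' y') (hA x y'), hA1 x' y]
    have p2 : A x' y * A x' y' * A x y' ≤ A x' y * A x' y' := by
      nlinarith [mul_nonneg (hA x' y) (hA x' y'), hA1 x y']
    have p0 : 0 ≤ A x' y * A x' y' * A x y' :=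
      mul_nonneg (mul_nonneg (hA _ _) (hA _ _)) (hA _ _)
    have q : 1 - lightPair A τ x x' * lightPair A τ y y' ≤
        (1 - lightPair A τ x x') + (1 - lightPair A τ y y') := by nlinarith
    have q1 := mul_le_mul_of_nonneg_left q p0
    have q2 := mul_le_mul_of_nonneg_left p1 (sub_nonneg.2 l2)
    have q3 := mul_le_mul_of_nonneg_left p2 (sub_nonneg.2 l4)
    have := mul_le_mul_of_nonneg_left (q1.trans (show _ ≤
      (1 - lightPair A τ x x') * (A x y' * A x' y') +
      (1 - lightPair A τ y y') * (A x' y * A x' y') by linarith)) (hA x y)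
    linarith
  refine (sum_le_sum fun x' _ => sum_le_sum fun y' _ => hpt x' y').trans ?_
  have b1 := sum_one_sub_lightPair_mul_codegree_le h01 hτ (hd x) (hK x)
  have b2 := sum_one_sub_lightPair_mul_codegree_le h01 hτ (hd y) (hK y)
  simp only [sum_add_distrib]
  rw [sum_comm (f := fun x' y' => A x y * ((1 - lightPair A τ y y') * (A y x' * A y' x')))]
  simp only [← mul_sum]
  nlinarith [mul_le_mul_of_nonneg_left b1 (hA x y), mul_le_mul_of_nonneg_left b2 (hA x y)]

/-- Once one end of `f` is `u`, the other is a common neighbour of `u` and an end of `g`. The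
corresponding diagonal is light, so there are at most `τ` choices; the factor `2` is for the two
ends. -/
theorem sum_lightStep_incident_le [DecidableEq V] (h01 : ∀ x y, A x y ^ 2 = A x y)
    (hs : ∀ x y, A x y = A y x) (hτ : 0 < τ) (g : V × V) (u : V) :
    ∑ f ∈ univ.filter (fun f : V × V => f.1 = u ∨ f.2 = u), lightStep A τ g f ≤
      2 * τ * A g.1 g.2 := by
  obtain ⟨x, y⟩ := g
  have hA : ∀ x y, 0 ≤ A x y := fun x y => by rw [← h01]; positivity
  have hA1 : ∀ x y, A x y ≤ 1 := fun x y => by nlinarith [h01 x y, hA x y]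
  have hpt : ∀ f : V × V, (if f.1 = u ∨ f.2 = u then lightStep A τ (x, y) f else 0) ≤
      (if f.1 = u then A x y * (lightPair A τ x u * (A x f.2 * A u f.2)) else 0) +
      (if f.2 = u then A x y * (lightPair A τ y u * (A y f.1 * A u f.1)) else 0) := by
    rintro ⟨x', y'⟩
    have l1 := lightPair_nonneg (A := A) (τ := τ) x x'
    have l2 := lightPair_le_one (A := A) (τ := τ) x x'
    have l3 := lightPair_nonneg (A := A) (τ := τ) y y'
    have l4 := lightPair_le_one (A := A) (τ := τ) y y'
    have c1 : lightStep A τ (x, y) (x', y') ≤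
        A x y * (lightPair A τ x x' * (A x y' * A x' y')) := by
      rw [lightStep]
      have h0 : 0 ≤ A x y * (lightPair A τ x x' * (A x y' * A x' y')) :=
        mul_nonneg (hA _ _) (mul_nonneg l1 (mul_nonneg (hA _ _) (hA _ _)))
      have h1 : A x' y * lightPair A τ y y' ≤ 1 := mul_le_one₀ (hA1 _ _) l3 l4
      calc _ = A x y * (lightPair A τ x x' * (A x y' * A x' y')) *
            (A x' y * lightPair A τ y y') := by ring
        _ ≤ _ := mul_le_of_le_one_right h0 h1
    have c2 : lightStep A τ (x, y) (x', y') ≤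
        A x y * (lightPair A τ y y' * (A y x' * A y' x')) := by
      rw [lightStep, hs y x', hs y' x']
      have h0 : 0 ≤ A x y * (lightPair A τ y y' * (A x' y * A x' y')) :=
        mul_nonneg (hA _ _) (mul_nonneg l3 (mul_nonneg (hA _ _) (hA _ _)))
      have h1 : A x y' * lightPair A τ x x' ≤ 1 := mul_le_one₀ (hA1 _ _) l1 l2
      calc _ = A x y * (lightPair A τ y y' * (A x' y * A x' y')) *
            (A x y' * lightPair A τ x x') := by ring
        _ ≤ _ := mul_le_of_le_one_right h0 h1
    have n1 : 0 ≤ A x y * (lightPair A τ x x' * (A x y' * A x' y')) :=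
      mul_nonneg (hA _ _) (mul_nonneg l1 (mul_nonneg (hA _ _) (hA _ _)))
    have n2 : 0 ≤ A x y * (lightPair A τ y y' * (A y x' * A y' x')) :=
      mul_nonneg (hA _ _) (mul_nonneg l3 (mul_nonneg (hA _ _) (hA _ _)))
    by_cases hx : x' = u
    · subst hx
      by_cases hy : y' = x'
      · subst hy
        simp only [or_self, if_true]
        linarith
      · simp [hy, c1]
    · by_cases hy : y' = u
      · subst hy
        simp [hx, c2]
      · simp [hx, hy]
  rw [sum_filter]
  refine (sum_le_sum fun f _ => hpt f).trans ?_
  rw [sum_add_distrib, Fintype.sum_prod_type, Fintype.sum_prod_type]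
  simp only [sum_ite_eq', mem_univ, if_true]
  rw [sum_comm]
  simp only [sum_ite_eq', mem_univ, if_true, ← mul_sum]
  have b1 := mul_le_mul_of_nonneg_left (lightPair_mul_codegree_le (A := A) hτ x u) (hA x y)
  have b2 := mul_le_mul_of_nonneg_left (lightPair_mul_codegree_le (A := A) hτ y u) (hA x y)
  linarith

/-- In a graph without `K_{3,3}` in which every edge lies in many four-cycles, there is a closed
walk of odd length along opposite edges of four-cycles whose edges are pairwise disjoint. -/
theorem exists_disjoint_closed_walk [DecidableEq V] (h01 : ∀ x y, A x y ^ 2 = A x y)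
    (hs : ∀ x y, A x y = A y x) (hloop : ∀ x, A x x = 0) (hτ : 0 < τ)
    (hd : ∀ a, 4 * ∑ y, A a y ≤ τ ^ 2)
    (hK : ∀ a b c, a ≠ b → a ≠ c → b ≠ c → ∑ y, A a y * A b y * A c y ≤ 2)
    (hne : ∃ x y, A x y ≠ 0) {t : ℝ} (ht : 0 < t)
    (hD : ∀ x y, A x y ≠ 0 → 120 * (∑ z, A x z + ∑ z, A y z) ≤
      ∑ x', ∑ y', A x' y * A x' y' * A x y')
    (hDt : ∀ x y, A x y ≠ 0 → t ≤ ∑ x', ∑ y', A x' y * A x' y' * A x y')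
    {ℓ : ℕ} (hℓ : 2 ≤ ℓ) (hℓt : 40 * (ℓ : ℝ) ^ 2 * τ ≤ 4 * t)
    (hN : 4 * (Fintype.card V : ℝ) ^ 2 * (9 / 10) ^ (ℓ - 2) ≤ (95 / 100) ^ ℓ) :
    ∃ w : Fin (ℓ + 1) → V × V, w 0 = w (Fin.last ℓ) ∧
      (∀ i : Fin ℓ, lightStep A τ (w i.castSucc) (w i.succ) ≠ 0) ∧
      ∀ i j : Fin ℓ, i < j → ∀ u, ((w i.castSucc).1 = u ∨ (w i.castSucc).2 = u) →
        ¬ ((w j.castSucc).1 = u ∨ (w j.castSucc).2 = u) := by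
  have hA : ∀ x y, 0 ≤ A x y := fun x y => by rw [← h01]; positivity
  have h01' : ∀ x y, A x y = 0 ∨ A x y = 1 := fun x y => by
    have h : A x y * (A x y - 1) = 0 := by linear_combination h01 x y
    rcases mul_eq_zero.1 h with h | h
    · exact Or.inl h
    · exact Or.inr (by linarith)
  let D : V × V → ℝ := fun e => ∑ x', ∑ y', A x' e.2 * A x' y' * A e.1 y'
  let W : V × V → V × V → ℝ := fun e f => A e.1 e.2 * A f.1 e.2 * A f.1 f.2 * A e.1 f.2
  let E : V × V → ℝ := fun e => A e.1 e.2 * D e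
  have hWsum : ∀ e, ∑ f, W e f = E e := by
    intro e
    simp only [W, E, D, Fintype.sum_prod_type, mul_sum]
    exact sum_congr rfl fun x' _ => sum_congr rfl fun y' _ => by ring
  have hWnn : ∀ e f, 0 ≤ W e f := fun e f =>
    mul_nonneg (mul_nonneg (mul_nonneg (hA _ _) (hA _ _)) (hA _ _)) (hA _ _)
  have hWs : ∀ e f, W e f = W f e := fun e f => by simp only [W]; ring
  have hmW : ∀ e f, lightStep A τ e f ≤ W e f := by
    intro e f
    have h1 : lightPair A τ e.1 f.1 * lightPair A τ e.2 f.2 ≤ 1 :=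
      mul_le_one₀ (lightPair_le_one _ _) (lightPair_nonneg _ _) (lightPair_le_one _ _)
    exact mul_le_of_le_one_right (hWnn e f) h1
  -- The loss of three times the sum of the degrees is a fraction `3 / 120` of the four-cycles at
  -- `e`.
  have hbad : ∀ e, ∑ f, (W e f - lightStep A τ e f) ≤ 1 / 40 * E e := by
    intro e
    refine (sum_not_lightStep_le h01 hs hτ hd hK e).trans ?_
    rcases h01' e.1 e.2 with h | h
    · simp [E, h]
    · have := hD e.1 e.2 (by rw [h]; exact one_ne_zero)
      simp only [E, D, h]
      linarith
  have hEnn : ∀ e, 0 ≤ E e := fun e => by rw [← hWsum]; exact sum_nonneg fun f _ => hWnn e f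
  -- The value `1` on pairs that are not edges only keeps the weight positive; all steps vanish
  -- there.
  let s : V × V → ℝ := fun e => if A e.1 e.2 = 0 then 1 else √(D e)
  have hDpos : ∀ e : V × V, A e.1 e.2 ≠ 0 → 0 < D e := fun e he => ht.trans_le (hDt e.1 e.2 he)
  have hspos : ∀ e, 0 < s e := by
    intro e
    simp only [s]
    split_ifs with h
    · exact one_pos
    · exact Real.sqrt_pos.2 (hDpos e h)
  have hs2 : ∀ e, A e.1 e.2 ≠ 0 → s e ^ 2 = D e := by
    intro e he
    simp only [s, if_neg he]
    exact Real.sq_sqrt (hDpos e he).le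
  have hEs : ∀ e, E e ≤ s e ^ 2 := by
    intro e
    rcases h01' e.1 e.2 with h | h
    · simp only [E, h, zero_mul]; positivity
    · rw [hs2 e (by rw [h]; exact one_ne_zero)]
      simp only [E, h, one_mul, le_refl]
  have hbadform : ∀ F : V × V → ℝ, ∑ e, ∑ f, (W e f - lightStep A τ e f) * F e * F f ≤
      1 / 40 * ∑ e, E e * F e ^ 2 := by
    intro F
    have hpt : ∀ e f, (W e f - lightStep A τ e f) * F e * F f ≤
        ((W e f - lightStep A τ e f) * F e ^ 2 + (W f e - lightStep A τ f e) * F f ^ 2) / 2 := by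
      intro e f
      rw [hWs f e, lightStep_comm f e]
      nlinarith [mul_nonneg (sub_nonneg.2 (hmW e f)) (sq_nonneg (F e - F f))]
    calc ∑ e, ∑ f, (W e f - lightStep A τ e f) * F e * F f
        ≤ ∑ e, ∑ f, ((W e f - lightStep A τ e f) * F e ^ 2 +
            (W f e - lightStep A τ f e) * F f ^ 2) / 2 :=
          sum_le_sum fun e _ => sum_le_sum fun f _ => hpt e f
      _ = ∑ e, ∑ f, (W e f - lightStep A τ e f) * F e ^ 2 := by
          simp only [← sum_div, sum_add_distrib]
          rw [sum_comm (f := fun e f => (W f e - lightStep A τ f e) * F f ^ 2)]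
          ring
      _ ≤ 1 / 40 * ∑ e, E e * F e ^ 2 := by
          rw [mul_sum]
          refine sum_le_sum fun e _ => ?_
          rw [← sum_mul, ← mul_assoc]
          exact mul_le_mul_of_nonneg_right (hbad e) (sq_nonneg _)
  have hsplit : ∀ F : V × V → ℝ, ∑ e, ∑ f, lightStep A τ e f * F e * F f =
      ∑ e, ∑ f, W e f * F e * F f - ∑ e, ∑ f, (W e f - lightStep A τ e f) * F e * F f := by
    intro F
    simp only [← sum_sub_distrib]
    exact sum_congr rfl fun e _ => sum_congr rfl fun f _ => by ring
  -- The bound `-1/2` for all four-cycles, less `1/40` for the discarded ones.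
  have hlow : ∀ F : V × V → ℝ, -(6 / 10) * ∑ e, s e ^ 2 * F e ^ 2 ≤
      ∑ e, ∑ f, lightStep A τ e f * F e * F f := by
    intro F
    have h1 := four_cycle_form_lower_bound hA fun x y => F (x, y)
    have h2 : ∑ e, ∑ f, W e f * F e * F f = ∑ x, ∑ y, ∑ x', ∑ y',
        A x y * A x' y * A x' y' * A x y' * (F (x, y) * F (x', y')) := by
      simp only [Fintype.sum_prod_type, W, mul_assoc]
    have h3 : ∑ e, E e * F e ^ 2 = ∑ x, ∑ y, ∑ x', ∑ y',
        A x y * A x' y * A x' y' * A x y' * F (x, y) ^ 2 := by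
      simp only [← hWsum, sum_mul, Fintype.sum_prod_type, W]
    rw [← h2, ← h3] at h1
    have h4 : ∑ e, E e * F e ^ 2 ≤ ∑ e, s e ^ 2 * F e ^ 2 :=
      sum_le_sum fun e _ => mul_le_mul_of_nonneg_right (hEs e) (sq_nonneg _)
    have h5 := hbadform F
    have h6 : 0 ≤ ∑ e, E e * F e ^ 2 :=
      sum_nonneg fun e _ => mul_nonneg (hEnn e) (sq_nonneg _)
    rw [hsplit]
    linarith
  have htop : ∃ F : V × V → ℝ, F ≠ 0 ∧ 95 / 100 * ∑ e, s e ^ 2 * F e ^ 2 ≤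
      ∑ e, ∑ f, lightStep A τ e f * F e * F f := by
    obtain ⟨x₀, y₀, h0⟩ := hne
    -- The indicator of the edges would give the value `1` if no step were discarded, so it gives at
    -- least `1 - 1/40`.
    refine ⟨fun e => A e.1 e.2, Function.ne_iff.2 ⟨(x₀, y₀), h0⟩, ?_⟩
    have h1 : ∀ e f, W e f * A e.1 e.2 * A f.1 f.2 = W e f := by
      intro e f
      calc _ = A e.1 e.2 ^ 2 * A f.1 e.2 * A f.1 f.2 ^ 2 * A e.1 f.2 := by simp only [W]; ring
        _ = _ := by rw [h01, h01]
    have h2 : ∀ e, s e ^ 2 * A e.1 e.2 ^ 2 = E e := by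
      intro e
      rcases h01' e.1 e.2 with h | h
      · simp [E, h]
      · rw [hs2 e (by rw [h]; exact one_ne_zero)]
        simp [E, h]
    have h3 := hbadform fun e => A e.1 e.2
    have h4 : ∀ e, E e * A e.1 e.2 ^ 2 = E e := by
      intro e
      rcases h01' e.1 e.2 with h | h <;> simp [E, h]
    have h5 : 0 ≤ ∑ e, E e := sum_nonneg fun e _ => hEnn e
    rw [hsplit]
    simp only [h1, h2, h4, hWsum] at h3 ⊢
    linarith
  obtain ⟨w, hw, hstep, hdisj⟩ := exists_closed_walk_of_weights
    (R := fun u : V => univ.filter fun f : V × V => f.1 = u ∨ f.2 = u)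
    (m := lightStep A τ) (s := s) (δ := 2 * τ / t) (lightStep_comm) (lightStep_nonneg hA) hspos
    (by positivity) hlow htop
    (fun e => ((sum_le_sum fun f _ => hmW e f).trans (hWsum e).le).trans (hEs e))
    (by
      intro u g
      refine (sum_lightStep_incident_le h01 hs hτ g u).trans ?_
      rcases h01' g.1 g.2 with h | h
      · rw [h, mul_zero]; positivity
      · have hne : A g.1 g.2 ≠ 0 := by rw [h]; exact one_ne_zero
        rw [hs2 g hne, h, mul_one, div_mul_eq_mul_div, le_div_iff₀ ht]
        exact mul_le_mul_of_nonneg_left (hDt g.1 g.2 hne) (by positivity))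
    (by
      intro e
      have hpt : ∀ u, (if e ∈ univ.filter (fun f : V × V => f.1 = u ∨ f.2 = u) then (1 : ℝ)
          else 0) ≤ (if e.1 = u then 1 else 0) + (if e.2 = u then 1 else 0) := by
        intro u
        by_cases h1 : e.1 = u <;> by_cases h2 : e.2 = u <;> simp [h1, h2]
      refine (sum_le_sum fun u _ => hpt u).trans ?_
      rw [sum_add_distrib, sum_ite_eq, sum_ite_eq, if_pos (mem_univ _), if_pos (mem_univ _)]
      norm_num)
    (by
      -- Two edges sharing `u` never form a step: either a diagonal degenerates, and is then not
      -- light, or a side is a loop.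
      intro u e he f hf
      have he' := (mem_filter.1 he).2
      have hf' := (mem_filter.1 hf).2
      rw [lightStep]
      rcases he' with he' | he' <;> rcases hf' with hf' | hf' <;>
        simp [he', hf', lightPair_self, hloop])
    hℓ
    (by
      rw [show (ℓ : ℝ) ^ 2 * (2 * (2 * τ / t)) = (40 * (ℓ : ℝ) ^ 2 * τ) / (10 * t) by
        field_simp; ring, div_le_iff₀ (by positivity)]
      linarith)
    (by
      rw [Fintype.card_prod]
      push_cast
      rw [← sq]
      exact hN)
  exact ⟨w, hw, hstep, fun i j hij u hi hj => hdisj i j hij u (by simpa using hi) (by simpa using hj)⟩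

end LightWalk

/-! ### Bounding the maximum degree. -/

section DegreeCap

open Finset

variable {V : Type*}

open Classical in
/-- The adjacency indicator of a graph. -/
noncomputable def adjInd (G : SimpleGraph V) (x y : V) : ℝ := if G.Adj x y then 1 else 0

theorem adjInd_sq (G : SimpleGraph V) (x y : V) : adjInd G x y ^ 2 = adjInd G x y := by
  rw [adjInd]; split_ifs <;> norm_num

theorem adjInd_nonneg (G : SimpleGraph V) (x y : V) : 0 ≤ adjInd G x y := by
  rw [adjInd]; split_ifs <;> norm_num

theorem adjInd_le_one (G : SimpleGraph V) (x y : V) : adjInd G x y ≤ 1 := by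
  rw [adjInd]; split_ifs <;> norm_num

theorem adjInd_comm (G : SimpleGraph V) (x y : V) : adjInd G x y = adjInd G y x := by
  by_cases h : G.Adj x y
  · rw [adjInd, adjInd, if_pos h, if_pos h.symm]
  · rw [adjInd, adjInd, if_neg h, if_neg (mt SimpleGraph.Adj.symm h)]

theorem adjInd_self (G : SimpleGraph V) (x : V) : adjInd G x x = 0 := by
  simp [adjInd]

theorem adjInd_ne_zero {G : SimpleGraph V} {x y : V} : adjInd G x y ≠ 0 ↔ G.Adj x y := by
  simp [adjInd]

theorem adjInd_of_adj {G : SimpleGraph V} {x y : V} (h : G.Adj x y) : adjInd G x y = 1 := by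
  simp [adjInd, h]

theorem adjInd_mono {G H : SimpleGraph V} (h : H ≤ G) (x y : V) : adjInd H x y ≤ adjInd G x y := by
  by_cases hxy : H.Adj x y
  · rw [adjInd_of_adj hxy, adjInd_of_adj (h hxy)]
  · have : adjInd H x y = 0 := by simpa using mt adjInd_ne_zero.1 hxy
    rw [this]
    exact adjInd_nonneg G x y

variable [Fintype V]

theorem sum_adjInd_eq (G : SimpleGraph V) [DecidableRel G.Adj] :
    ∑ x, ∑ y, adjInd G x y = 2 * (G.edgeFinset.card : ℝ) := by
  classical
  have h : ∀ x, ∑ y, adjInd G x y = (G.degree x : ℝ) := by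
    intro x
    rw [← SimpleGraph.card_neighborFinset_eq_degree, SimpleGraph.neighborFinset_eq_filter,
      natCast_card_filter]
    refine sum_congr rfl fun y _ => ?_
    by_cases hxy : G.Adj x y <;> simp [adjInd, hxy]
  simp only [h]
  exact_mod_cast G.sum_degrees_eq_twice_card_edges

theorem sum_adjInd_triple_le {G : SimpleGraph V} (hG : ¬ HasCycleDiag G) {a b c : V} (hab : a ≠ b)
    (hac : a ≠ c) (hbc : b ≠ c) : ∑ y, adjInd G a y * adjInd G b y * adjInd G c y ≤ 2 := by
  classical
  have h1 : ∑ y, adjInd G a y * adjInd G b y * adjInd G c y =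
      ((univ.filter fun y => G.Adj a y ∧ G.Adj b y ∧ G.Adj c y).card : ℝ) := by
    rw [card_filter]
    push_cast
    refine sum_congr rfl fun y _ => ?_
    by_cases h1 : G.Adj a y <;> by_cases h2 : G.Adj b y <;> by_cases h3 : G.Adj c y <;>
      simp [adjInd, h1, h2, h3]
  rw [h1]
  by_contra! hcon
  have hcon' : 2 < (univ.filter fun y => G.Adj a y ∧ G.Adj b y ∧ G.Adj c y).card := by
    exact_mod_cast hcon
  obtain ⟨x, y, z, hx, hy, hz, hxy, hxz, hyz⟩ := two_lt_card_iff.1 hcon'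
  simp only [mem_filter, mem_univ, true_and] at hx hy hz
  exact hG (hasCycleDiag_of_completeBipartite hab hac hbc hxy hxz hyz hx.1 hy.1 hz.1 hx.2.1 hy.2.1
    hz.2.1 hx.2.2 hy.2.2 hz.2.2)

/-- A Kővári–Sós–Turán count with third moments: without `K_{3,3}`, triples of distinct vertices in
`S` have at most two common neighbours. Degrees into `S` below `z` contribute the first term, those
above it are controlled by the third moment. -/
theorem sum_degree_into_le {A : V → V → ℝ} (h01 : ∀ x y, A x y ^ 2 = A x y)
    (hK : ∀ a b c, a ≠ b → a ≠ c → b ≠ c → ∑ y, A a y * A b y * A c y ≤ 2) (S : Finset V)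
    {z : ℝ} (hz : 6 ≤ z) :
    ∑ v, ∑ a ∈ S, A a v ≤ 2 * (Fintype.card V * z) + 4 * (S.card : ℝ) ^ 3 / z ^ 2 := by
  classical
  have hA : ∀ x y, 0 ≤ A x y := fun x y => by rw [← h01]; positivity
  have hA1 : ∀ x y, A x y ≤ 1 := fun x y => by nlinarith [h01 x y, hA x y]
  set d : V → ℝ := fun v => ∑ a ∈ S, A a v with hd
  have hd0 : ∀ v, 0 ≤ d v := fun v => sum_nonneg fun a _ => hA a v
  have hcube : ∑ v, d v ^ 3 ≤ 2 * (S.card : ℝ) ^ 3 + 3 * ∑ v, d v ^ 2 := by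
    have e2 : ∑ a ∈ S, ∑ b ∈ S, ∑ v, A a v * A b v = ∑ v, d v ^ 2 := by
      simp only [hd, sq, sum_mul_sum]
      rw [sum_comm (s := (univ : Finset V))]
      exact sum_congr rfl fun a _ => sum_comm
    have e3 : ∑ v, d v ^ 3 = ∑ a ∈ S, ∑ b ∈ S, ∑ c ∈ S, ∑ v, A a v * A b v * A c v := by
      have : ∀ v, d v ^ 3 = ∑ a ∈ S, ∑ b ∈ S, ∑ c ∈ S, A a v * A b v * A c v := by
        intro v
        rw [pow_succ, sq]
        simp only [hd, sum_mul, mul_sum]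
        exact sum_congr rfl fun a _ => sum_congr rfl fun b _ => sum_congr rfl fun c _ => by ring
      simp only [this]
      rw [sum_comm]
      refine sum_congr rfl fun a _ => ?_
      rw [sum_comm]
      exact sum_congr rfl fun b _ => sum_comm
    have hpt : ∀ a b c, ∑ v, A a v * A b v * A c v ≤ 2 +
        ((if a = b then ∑ v, A a v * A c v else 0) + (if a = c then ∑ v, A a v * A b v else 0) +
          (if b = c then ∑ v, A a v * A b v else 0)) := by
      intro a b c
      have n1 : ∀ a b, 0 ≤ ∑ v, A a v * A b v := fun a b =>
        sum_nonneg fun v _ => mul_nonneg (hA _ _) (hA _ _)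
      have le1 : ∑ v, A a v * A b v * A c v ≤ ∑ v, A a v * A b v :=
        sum_le_sum fun v _ => mul_le_of_le_one_right (mul_nonneg (hA _ _) (hA _ _)) (hA1 _ _)
      have le2 : ∑ v, A a v * A b v * A c v ≤ ∑ v, A a v * A c v :=
        sum_le_sum fun v _ => by
          rw [mul_right_comm]
          exact mul_le_of_le_one_right (mul_nonneg (hA _ _) (hA _ _)) (hA1 _ _)
      have := n1 a b
      have := n1 a c
      by_cases hab : a = b
      · rw [if_pos hab]
        split_ifs <;> linarith
      · by_cases hac : a = c
        · rw [if_pos hac]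
          split_ifs <;> linarith
        · by_cases hbc : b = c
          · rw [if_pos hbc]
            split_ifs <;> linarith
          · rw [if_neg hab, if_neg hac, if_neg hbc]
            linarith [hK a b c hab hac hbc]
    rw [e3]
    refine (sum_le_sum fun a _ => sum_le_sum fun b _ => sum_le_sum fun c _ => hpt a b c).trans ?_
    simp only [sum_add_distrib]
    have f1 : ∑ a ∈ S, ∑ b ∈ S, ∑ c ∈ S, (if a = b then ∑ v, A a v * A c v else 0) =
        ∑ v, d v ^ 2 := by
      rw [← e2]
      refine sum_congr rfl fun a ha => ?_
      rw [sum_comm]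
      refine sum_congr rfl fun c _ => ?_
      rw [sum_ite_eq, if_pos ha]
    have f2 : ∑ a ∈ S, ∑ b ∈ S, ∑ c ∈ S, (if a = c then ∑ v, A a v * A b v else 0) =
        ∑ v, d v ^ 2 := by
      rw [← e2]
      refine sum_congr rfl fun a ha => sum_congr rfl fun b _ => ?_
      rw [sum_ite_eq, if_pos ha]
    have f3 : ∑ a ∈ S, ∑ b ∈ S, ∑ c ∈ S, (if b = c then ∑ v, A a v * A b v else 0) =
        ∑ v, d v ^ 2 := by
      rw [← e2]
      refine sum_congr rfl fun a ha => sum_congr rfl fun b hb => ?_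
      rw [sum_ite_eq, if_pos hb]
    rw [f1, f2, f3]
    simp only [sum_const, nsmul_eq_mul]
    apply le_of_eq
    ring
  have hpt : ∀ v, d v ≤ z + 2 / z ^ 2 * (d v ^ 3 - 3 * d v ^ 2 + 4) := by
    intro v
    have hz2 : 0 < z ^ 2 := by positivity
    have hd := hd0 v
    have h4 : 0 ≤ d v ^ 3 - 3 * d v ^ 2 + 4 := by
      -- The polynomial is `(d + 1) * (d - 2) ^ 2`, which replaces the falling factorial `d * (d -
      -- 1) * (d - 2)`.
      nlinarith [mul_nonneg (by linarith : 0 ≤ d v + 1) (sq_nonneg (d v - 2))]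
    rcases le_total (d v) z with h | h
    · have : 0 ≤ 2 / z ^ 2 * (d v ^ 3 - 3 * d v ^ 2 + 4) := by positivity
      linarith
    · have h6 : z ^ 2 * d v ≤ 2 * (d v ^ 3 - 3 * d v ^ 2 + 4) := by
        have a1 : z ^ 2 ≤ d v ^ 2 := pow_le_pow_left₀ (by linarith) h 2
        nlinarith [mul_le_mul_of_nonneg_right a1 hd, mul_nonneg (sq_nonneg (d v))
          (by linarith : 0 ≤ d v - 6)]
      have : d v ≤ 2 / z ^ 2 * (d v ^ 3 - 3 * d v ^ 2 + 4) := by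
        rw [div_mul_eq_mul_div, le_div_iff₀ hz2]
        linarith
      linarith
  have hn : (0 : ℝ) ≤ Fintype.card V := by positivity
  calc ∑ v, d v ≤ ∑ v, (z + 2 / z ^ 2 * (d v ^ 3 - 3 * d v ^ 2 + 4)) := sum_le_sum fun v _ => hpt v
    _ = Fintype.card V * z + 2 / z ^ 2 * (∑ v, d v ^ 3 - 3 * ∑ v, d v ^ 2 +
          4 * Fintype.card V) := by
        simp only [sum_add_distrib, ← mul_sum, sum_sub_distrib, sum_const, card_univ, nsmul_eq_mul]
        ring
    _ ≤ Fintype.card V * z + 2 / z ^ 2 * (2 * (S.card : ℝ) ^ 3 + 4 * Fintype.card V) := by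
        have : 0 ≤ 2 / z ^ 2 := by positivity
        have := mul_le_mul_of_nonneg_left (show ∑ v, d v ^ 3 - 3 * ∑ v, d v ^ 2 +
          4 * (Fintype.card V : ℝ) ≤ 2 * (S.card : ℝ) ^ 3 + 4 * Fintype.card V by linarith) this
        linarith
    _ ≤ 2 * (Fintype.card V * z) + 4 * (S.card : ℝ) ^ 3 / z ^ 2 := by
        have h8 : 8 / z ^ 2 ≤ z := by
          rw [div_le_iff₀ (by positivity)]
          nlinarith [sq_nonneg z]
        have h9 := mul_le_mul_of_nonneg_left h8 hn
        have : 2 / z ^ 2 * (2 * (S.card : ℝ) ^ 3 + 4 * Fintype.card V) =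
            4 * (S.card : ℝ) ^ 3 / z ^ 2 + Fintype.card V * (8 / z ^ 2) := by ring
        linarith

/-- A dense graph without `K_{3,3}` has a dense subgraph of small maximum degree. -/
theorem exists_subgraph_degree_le (G : SimpleGraph V)
    (hK : ∀ a b c, a ≠ b → a ≠ c → b ≠ c → ∑ y, adjInd G a y * adjInd G b y * adjInd G c y ≤ 2)
    {x K : ℝ} (hx : 1 ≤ x) (hxn : x ^ 6 = Fintype.card V) (hK96 : 96 ≤ K)
    (hE : K * x ^ 9 ≤ ∑ a, ∑ b, adjInd G a b) :
    ∃ H ≤ G, (∀ a, ∑ b, adjInd H a b ≤ 21 * x ^ 4) ∧ K / 2 * x ^ 9 ≤ ∑ a, ∑ b, adjInd H a b := by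
  classical
  have hx3 : 1 ≤ x ^ 3 := one_le_pow₀ hx
  have hx4 : 1 ≤ x ^ 4 := one_le_pow₀ hx
  have hx9 : 0 < x ^ 9 := by positivity
  -- A maximal subgraph under the degree cap: each edge of `G` left out has an end in the set `S` of
  -- saturated vertices. If `H` had few edges, `S` would be small, and too few edges of `G` would
  -- meet `S`.
  obtain ⟨H, ⟨hHG, hHd⟩, hmax⟩ := (Set.toFinite {H : SimpleGraph V |
    H ≤ G ∧ ∀ a, ∑ b, adjInd H a b ≤ 21 * x ^ 4}).exists_maximal
    ⟨⊥, bot_le, fun a => by simp only [adjInd, SimpleGraph.bot_adj, if_false, sum_const_zero]; positivity⟩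
  refine ⟨H, hHG, hHd, ?_⟩
  by_contra! hcon
  set S : Finset V := univ.filter fun a => 21 * x ^ 4 - 1 < ∑ b, adjInd H a b with hS
  have hScard : (S.card : ℝ) * (20 * x ^ 4) ≤ K / 2 * x ^ 9 := by
    have h1 : (S.card : ℝ) * (20 * x ^ 4) ≤ ∑ a ∈ S, ∑ b, adjInd H a b := by
      rw [← nsmul_eq_mul]
      refine card_nsmul_le_sum _ _ _ fun a ha => ?_
      have := (mem_filter.1 ha).2
      linarith
    have h2 : ∑ a ∈ S, ∑ b, adjInd H a b ≤ ∑ a, ∑ b, adjInd H a b :=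
      sum_le_sum_of_subset_of_nonneg (subset_univ _)
        fun a _ _ => sum_nonneg fun b _ => adjInd_nonneg H a b
    linarith
  have hcover : ∀ a b, G.Adj a b → ¬ H.Adj a b → a ∈ S ∨ b ∈ S := by
    intro a b hG hH
    by_contra! hab
    have hval : ∀ c e, adjInd (H ⊔ SimpleGraph.edge a b) c e ≤
        adjInd H c e + ((if c = a ∧ e = b then 1 else 0) + (if c = b ∧ e = a then 1 else 0)) := by
      intro c e
      by_cases h : (H ⊔ SimpleGraph.edge a b).Adj c e
      · rw [adjInd_of_adj h]
        have hn := adjInd_nonneg H c e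
        rw [SimpleGraph.sup_adj, SimpleGraph.edge_adj] at h
        rcases h with h | ⟨h | h, -⟩
        · rw [adjInd_of_adj h]
          split_ifs <;> norm_num
        · rw [if_pos ⟨h.1, h.2⟩]
          split_ifs <;> linarith
        · rw [if_pos (c := c = b ∧ e = a) ⟨h.1, h.2⟩]
          split_ifs <;> linarith
      · have h0 : adjInd (H ⊔ SimpleGraph.edge a b) c e = 0 := by
          simpa using mt adjInd_ne_zero.1 h
        rw [h0]
        have hn := adjInd_nonneg H c e
        split_ifs <;> linarith
    have hle : H ⊔ SimpleGraph.edge a b ≤ H := by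
      refine hmax ⟨sup_le hHG ?_, fun c => ?_⟩ le_sup_left
      · intro c e h
        rw [SimpleGraph.edge_adj] at h
        rcases h with ⟨⟨rfl, rfl⟩ | ⟨rfl, rfl⟩, -⟩
        · exact hG
        · exact hG.symm
      · refine (sum_le_sum fun e _ => hval c e).trans ?_
        have ha : ∑ e, adjInd H a e ≤ 21 * x ^ 4 - 1 := by
          simpa [S] using hab.1
        have hb : ∑ e, adjInd H b e ≤ 21 * x ^ 4 - 1 := by
          simpa [S] using hab.2
        rw [sum_add_distrib, sum_add_distrib]
        have hne := hG.ne
        by_cases hca : c = a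
        · subst hca
          simp [hne]
          linarith
        · by_cases hcb : c = b
          · subst hcb
            simp [hca]
            linarith
          · simp [hca, hcb]
            exact hHd c
    exact hH (hle (Or.inr (by rw [SimpleGraph.edge_adj]; exact ⟨Or.inl ⟨rfl, rfl⟩, hG.ne⟩)))
  have hEG : ∑ a, ∑ b, adjInd G a b ≤
      ∑ a, ∑ b, adjInd H a b + 2 * ∑ v, ∑ a ∈ S, adjInd G a v := by
    have hpt : ∀ a b, adjInd G a b ≤ adjInd H a b + ((if a ∈ S then adjInd G a b else 0) +
        (if b ∈ S then adjInd G b a else 0)) := by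
      intro a b
      have n1 := adjInd_nonneg G a b
      have n2 := adjInd_nonneg H a b
      rw [adjInd_comm G b a]
      by_cases hG : G.Adj a b
      · by_cases hH : H.Adj a b
        · rw [adjInd_of_adj hG, adjInd_of_adj hH]
          split_ifs <;> norm_num
        · rcases hcover a b hG hH with h | h
          · rw [if_pos h]; split_ifs <;> linarith
          · rw [if_pos h]; split_ifs <;> linarith
      · have h0 : adjInd G a b = 0 := by simpa using mt adjInd_ne_zero.1 hG
        rw [h0] at n1 ⊢
        split_ifs <;> linarith
    refine (sum_le_sum fun a _ => sum_le_sum fun b _ => hpt a b).trans ?_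
    simp only [sum_add_distrib]
    rw [sum_comm (f := fun a b => if a ∈ S then adjInd G a b else 0)]
    simp only [sum_ite_mem, univ_inter]
    linarith
  -- This `z` makes both terms small multiples of `K * x ^ 9`: after doubling they are `K / 4` and
  -- `K / 25`, below the missing half.
  have hW := sum_degree_into_le (adjInd_sq G) hK S (z := K / 16 * x ^ 3) (by nlinarith)
  rw [← hxn] at hW
  have hS5 : (S.card : ℝ) ≤ K / 40 * x ^ 5 := by
    have : (S.card : ℝ) * (20 * x ^ 4) ≤ K / 40 * x ^ 5 * (20 * x ^ 4) := by
      calc _ ≤ K / 2 * x ^ 9 := hScard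
        _ = _ := by ring
    exact le_of_mul_le_mul_right this (by positivity)
  have hS3 : 4 * (S.card : ℝ) ^ 3 / (K / 16 * x ^ 3) ^ 2 ≤ K / 50 * x ^ 9 := by
    rw [div_le_iff₀ (by positivity)]
    have := pow_le_pow_left₀ (by positivity) hS5 3
    calc 4 * (S.card : ℝ) ^ 3 ≤ 4 * (K / 40 * x ^ 5) ^ 3 := by linarith
      _ = 1 / 16000 * (K ^ 3 * x ^ 15) := by ring
      _ ≤ 1 / 12800 * (K ^ 3 * x ^ 15) := by
        have : 0 ≤ K ^ 3 * x ^ 15 := by positivity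
        linarith
      _ = K / 50 * x ^ 9 * (K / 16 * x ^ 3) ^ 2 := by ring
  have hz : 2 * (x ^ 6 * (K / 16 * x ^ 3)) = K / 8 * x ^ 9 := by ring
  have : 0 < K * x ^ 9 := by positivity
  linarith

end DegreeCap

/-! ### Finding a subgraph with many four-cycles at each edge. -/

section Cleaning

open Finset

variable {V : Type*} [Fintype V]

/-- The number of homomorphic four-cycles, for a weighted adjacency function. -/
noncomputable def fourCycleCount (A : V → V → ℝ) : ℝ :=
  ∑ x, ∑ y, ∑ x', ∑ y', A x y * A x' y * A x' y' * A x y'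

theorem sum_swap_snd_fst (g : V → V → V → V → ℝ) :
    ∑ x, ∑ y, ∑ x', ∑ y', g x y x' y' = ∑ x, ∑ y, ∑ x', ∑ y', g x y' x' y := by
  refine sum_congr rfl fun x _ => ?_
  calc ∑ y, ∑ x', ∑ y', g x y x' y' = ∑ x', ∑ y, ∑ y', g x y x' y' := sum_comm
    _ = ∑ x', ∑ y', ∑ y, g x y x' y' := sum_congr rfl fun x' _ => sum_comm
    _ = _ := sum_comm

theorem sum_swap_fst_snd (g : V → V → V → V → ℝ) :
    ∑ x, ∑ y, ∑ x', ∑ y', g x y x' y' = ∑ x, ∑ y, ∑ x', ∑ y', g x' y x y' := by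
  calc ∑ x, ∑ y, ∑ x', ∑ y', g x y x' y' = ∑ y, ∑ x, ∑ x', ∑ y', g x y x' y' := sum_comm
    _ = ∑ y, ∑ x', ∑ x, ∑ y', g x y x' y' := sum_congr rfl fun x' _ => sum_comm
    _ = _ := sum_comm

theorem sq_sum_le_card_mul_sum_degree_sq (A : V → V → ℝ) :
    (∑ x, ∑ y, A x y) ^ 2 ≤ Fintype.card V * ∑ x, (∑ y, A x y) ^ 2 :=
  sq_sum_le_card_mul_sum_sq

theorem sq_sum_degree_sq_le (A : V → V → ℝ) (hs : ∀ x y, A x y = A y x) :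
    (∑ x, (∑ y, A x y) ^ 2) ^ 2 ≤ (Fintype.card V : ℝ) ^ 2 * fourCycleCount A := by
  have e1 : ∑ x, (∑ y, A x y) ^ 2 = ∑ p : V × V, ∑ y, A p.1 y * A p.2 y := by
    rw [Fintype.sum_prod_type]
    simp only [sq, sum_mul_sum]
    calc ∑ x, ∑ y, ∑ z, A x y * A x z = ∑ y, ∑ x, ∑ z, A x y * A x z := sum_comm
      _ = ∑ y, ∑ z, ∑ x, A x y * A x z := sum_congr rfl fun y _ => sum_comm
      _ = _ := by
        refine sum_congr rfl fun y _ => sum_congr rfl fun z _ => sum_congr rfl fun x _ => ?_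
        rw [hs x y, hs x z]
  have e2 : fourCycleCount A = ∑ p : V × V, (∑ y, A p.1 y * A p.2 y) ^ 2 := by
    rw [Fintype.sum_prod_type, fourCycleCount]
    refine sum_congr rfl fun x _ => ?_
    rw [sum_comm]
    refine sum_congr rfl fun x' _ => ?_
    rw [sq, sum_mul_sum]
    exact sum_congr rfl fun y _ => sum_congr rfl fun y' _ => by ring
  rw [e1, e2]
  have := sq_sum_le_card_mul_sum_sq (s := (univ : Finset (V × V)))
    (f := fun p => ∑ y, A p.1 y * A p.2 y)
  rwa [card_univ, Fintype.card_prod, Nat.cast_mul, ← sq] at this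

/-- A homomorphic four-cycle is lost only if one of its four sides is; telescoping treats the sides
one at a time, and all four give the same sum by symmetry. -/
theorem fourCycleCount_sub_le {A B : V → V → ℝ} (hB : ∀ x y, 0 ≤ B x y)
    (hBA : ∀ x y, B x y ≤ A x y) (hs : ∀ x y, A x y = A y x) (hsB : ∀ x y, B x y = B y x) :
    fourCycleCount A - fourCycleCount B ≤
      4 * ∑ x, ∑ y, ∑ x', ∑ y', (A x y - B x y) * (A x' y * A x' y' * A x y') := by
  have hA : ∀ x y, 0 ≤ A x y := fun x y => (hB x y).trans (hBA x y)
  set E : V → V → ℝ := fun x y => A x y - B x y with hE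
  have hEnn : ∀ x y, 0 ≤ E x y := fun x y => sub_nonneg.2 (hBA x y)
  have hpt : ∀ x y x' y', A x y * A x' y * A x' y' * A x y' - B x y * B x' y * B x' y' * B x y' ≤
      E x y * (A x' y * A x' y' * A x y') + E x' y * (A x y * A x' y' * A x y') +
      E x' y' * (A x y * A x' y * A x y') + E x y' * (A x y * A x' y * A x' y') := by
    intro x y x' y'
    have tele : ∀ p₁ p₂ p₃ p₄ q₁ q₂ q₃ q₄ : ℝ, 0 ≤ q₁ → 0 ≤ q₂ → 0 ≤ q₃ → q₁ ≤ p₁ → q₂ ≤ p₂ →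
        q₃ ≤ p₃ → q₄ ≤ p₄ → 0 ≤ p₄ → p₁ * p₂ * p₃ * p₄ - q₁ * q₂ * q₃ * q₄ ≤
        (p₁ - q₁) * (p₂ * p₃ * p₄) + (p₂ - q₂) * (p₁ * p₃ * p₄) + (p₃ - q₃) * (p₁ * p₂ * p₄) +
        (p₄ - q₄) * (p₁ * p₂ * p₃) := by
      intro p₁ p₂ p₃ p₄ q₁ q₂ q₃ q₄ h1 h2 h3 l1 l2 l3 l4 h4
      have m12 : q₁ * q₂ ≤ p₁ * p₂ := mul_le_mul l1 l2 h2 (h1.trans l1)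
      have m123 : q₁ * q₂ * q₃ ≤ p₁ * p₂ * p₃ :=
        mul_le_mul m12 l3 h3 (mul_nonneg (h1.trans l1) (h2.trans l2))
      have t2 := mul_le_mul_of_nonneg_left l1 (mul_nonneg (sub_nonneg.2 l2)
        (mul_nonneg (h3.trans l3) h4))
      have t3 := mul_le_mul_of_nonneg_left m12 (mul_nonneg (sub_nonneg.2 l3) h4)
      have t4 := mul_le_mul_of_nonneg_left m123 (sub_nonneg.2 l4)
      nlinarith
    exact tele _ _ _ _ _ _ _ _ (hB _ _) (hB _ _) (hB _ _) (hBA _ _) (hBA _ _) (hBA _ _)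
      (hBA _ _) (hA _ _)
  have hEs : ∀ x y, E x y = E y x := fun x y => by simp only [hE, hs x y, hsB x y]
  set T := ∑ x, ∑ y, ∑ x', ∑ y', E x y * (A x' y * A x' y' * A x y') with hT
  have h2 : ∑ x, ∑ y, ∑ x', ∑ y', E x' y * (A x y * A x' y' * A x y') = T := by
    rw [sum_swap_fst_snd]
    exact sum_congr rfl fun x _ => sum_congr rfl fun y _ => sum_congr rfl fun x' _ =>
      sum_congr rfl fun y' _ => by ring
  have h4 : ∑ x, ∑ y, ∑ x', ∑ y', E x y' * (A x y * A x' y * A x' y') = T := by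
    rw [sum_swap_snd_fst]
    exact sum_congr rfl fun x _ => sum_congr rfl fun y _ => sum_congr rfl fun x' _ =>
      sum_congr rfl fun y' _ => by ring
  have h3 : ∑ x, ∑ y, ∑ x', ∑ y', E x' y' * (A x y * A x' y * A x y') = T := by
    rw [sum_swap_fst_snd, ← h4]
    exact sum_congr rfl fun x _ => sum_congr rfl fun y _ => sum_congr rfl fun x' _ =>
      sum_congr rfl fun y' _ => by ring
  rw [fourCycleCount, fourCycleCount]
  simp only [← sum_sub_distrib]
  refine (sum_le_sum fun x _ => sum_le_sum fun y _ => sum_le_sum fun x' _ =>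
    sum_le_sum fun y' _ => hpt x y x' y').trans ?_
  simp only [sum_add_distrib]
  rw [h2, h3, h4]
  linarith

/-- A graph with many four-cycles has a subgraph in which each edge is in many four-cycles,
compared with the degrees of its ends and with `β`. -/
theorem exists_subgraph_many_four_cycles (G : SimpleGraph V) {B β : ℝ} (hB : 0 ≤ B)
    (hpos : 0 < fourCycleCount (adjInd G) - B * ∑ x, (∑ y, adjInd G x y) ^ 2 -
      β * ∑ x, ∑ y, adjInd G x y) :
    ∃ H ≤ G, H ≠ ⊥ ∧ ∀ a b, H.Adj a b →
      B * (∑ y, adjInd H a y + ∑ y, adjInd H b y) + 2 * β ≤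
        8 * ∑ x', ∑ y', adjInd H x' b * adjInd H x' y' * adjInd H a y' := by
  classical
  -- For a maximiser of `Φ`, deleting an edge does not increase it, so the four-cycles lost must pay
  -- for the gain in the two negative terms.
  let Φ : SimpleGraph V → ℝ := fun H => fourCycleCount (adjInd H) -
    B * ∑ x, (∑ y, adjInd H x y) ^ 2 - β * ∑ x, ∑ y, adjInd H x y
  have : Nonempty {H : SimpleGraph V // H ≤ G} := ⟨⟨G, le_rfl⟩⟩
  obtain ⟨⟨H, hHG⟩, hmax⟩ := Finite.exists_max fun H : {H : SimpleGraph V // H ≤ G} => Φ H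
  have hΦ : 0 < Φ H := lt_of_lt_of_le hpos (hmax ⟨G, le_rfl⟩)
  refine ⟨H, hHG, ?_, fun a b hab => ?_⟩
  · rintro rfl
    have h0 : ∀ x y, adjInd (⊥ : SimpleGraph V) x y = 0 := fun x y => by simp [adjInd]
    simp [Φ, fourCycleCount, h0] at hΦ
  · set H' := H.deleteEdges {s(a, b)} with hH'
    have hle : Φ H' ≤ Φ H := hmax ⟨H', (H.deleteEdges_le _).trans hHG⟩
    have hne := hab.ne
    set I : V → V → ℝ := fun x y =>
      (if x = a ∧ y = b then 1 else 0) + (if x = b ∧ y = a then 1 else 0) with hI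
    have hval : ∀ x y, adjInd H x y - adjInd H' x y = I x y := by
      intro x y
      by_cases h1 : x = a ∧ y = b
      · obtain ⟨rfl, rfl⟩ := h1
        simp [hI, adjInd, hH', hab, hne]
      · by_cases h2 : x = b ∧ y = a
        · obtain ⟨rfl, rfl⟩ := h2
          simp [hI, adjInd, hH', hab.symm, hne.symm]
        · have : H'.Adj x y ↔ H.Adj x y := by
            rw [hH', SimpleGraph.deleteEdges_adj, Set.mem_singleton_iff, Sym2.eq_iff]
            tauto
          by_cases h3 : H.Adj x y
          · rw [adjInd_of_adj h3, adjInd_of_adj (this.2 h3)]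
            simp [hI, h1, h2]
          · simp [hI, h1, h2, adjInd, h3, this]
    have hsumI : ∀ g : V → V → ℝ, ∑ x, ∑ y, I x y * g x y = g a b + g b a := by
      intro g
      simp only [hI, add_mul, sum_add_distrib, ite_and, ite_mul, one_mul, zero_mul]
      simp
    set D : V → V → ℝ := fun x y => ∑ x', ∑ y', adjInd H x' y * adjInd H x' y' * adjInd H x y'
      with hD
    have hDs : D b a = D a b := by
      simp only [hD]
      rw [sum_comm]
      refine sum_congr rfl fun x' _ => sum_congr rfl fun y' _ => ?_
      rw [adjInd_comm H y' a, adjInd_comm H y' x', adjInd_comm H b x']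
      ring
    -- Four positions in the cycle times two orientations of the deleted edge.
    have hcyc : fourCycleCount (adjInd H) - fourCycleCount (adjInd H') ≤ 8 * D a b := by
      refine (fourCycleCount_sub_le (adjInd_nonneg H') (adjInd_mono (H.deleteEdges_le _))
        (adjInd_comm H) (adjInd_comm H')).trans (le_of_eq ?_)
      simp only [hval, ← mul_sum]
      rw [hsumI D, hDs]
      ring
    have hE : ∑ x, ∑ y, adjInd H x y - ∑ x, ∑ y, adjInd H' x y = 2 := by
      simp only [← sum_sub_distrib, hval]
      have := hsumI fun _ _ => 1
      simp only [mul_one] at this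
      rw [this]
      norm_num
    have hdeg : ∀ x, ∑ y, adjInd H x y - ∑ y, adjInd H' x y =
        (if x = a then 1 else 0) + (if x = b then 1 else 0) := by
      intro x
      simp only [← sum_sub_distrib, hval, hI, sum_add_distrib, ite_and]
      by_cases h1 : x = a <;> by_cases h2 : x = b <;> simp [h1, h2]
    -- At each end the degree `d` drops by one, and `d ^ 2 - (d - 1) ^ 2 ≥ d` because `d ≥ 1`.
    have hsq : ∑ y, adjInd H a y + ∑ y, adjInd H b y ≤
        ∑ x, (∑ y, adjInd H x y) ^ 2 - ∑ x, (∑ y, adjInd H' x y) ^ 2 := by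
      have hpt : ∀ x, ((if x = a then ∑ y, adjInd H a y else 0) +
          (if x = b then ∑ y, adjInd H b y else 0)) ≤
          (∑ y, adjInd H x y) ^ 2 - (∑ y, adjInd H' x y) ^ 2 := by
        intro x
        have hd := hdeg x
        have h0 : 0 ≤ ∑ y, adjInd H' x y := sum_nonneg fun y _ => adjInd_nonneg H' x y
        by_cases h1 : x = a
        · subst h1
          simp only [hne, if_true, if_false, add_zero] at hd ⊢
          nlinarith
        · by_cases h2 : x = b
          · subst h2
            simp only [h1, if_true, if_false, zero_add] at hd ⊢
            nlinarith
          · simp only [h1, h2, if_false, add_zero] at hd ⊢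
            rw [sub_eq_zero.1 hd, sub_self]
      have := sum_le_sum fun x (_ : x ∈ univ) => hpt x
      simpa [sum_add_distrib, sum_sub_distrib] using this
    have := mul_le_mul_of_nonneg_left hsq hB
    simp only [Φ] at hle
    have hE' := congrArg (fun r => β * r) hE
    simp only [mul_sub] at hE' this
    change _ ≤ 8 * D a b
    linarith

end Cleaning

/-! ### Choice of the length of the walk. -/

section WalkLength

open Filter Topology

/-- Suitable lengths of closed walks: odd, short compared with `y ^ 2`, but long enough to make
powers of `9 / 10` negligible. -/
theorem exists_walk_length : ∃ y₀ : ℝ, 1 ≤ y₀ ∧ ∀ y : ℝ, y₀ ≤ y → ∃ k : ℕ, 1 ≤ k ∧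
    100 * ((2 * k + 1 : ℕ) : ℝ) ^ 2 ≤ y ^ 4 ∧
    4 * (y ^ 24) ^ 2 * (9 / 10) ^ (2 * k + 1 - 2) ≤ (95 / 100 : ℝ) ^ (2 * k + 1) := by
  -- `324 / 361` is the square of the ratio of `9/10` to `95/100`, two factors for each increase of
  -- `k` by one.
  have hlim := tendsto_pow_const_mul_const_pow_of_abs_lt_one 48 (r := (324 / 361 : ℝ))
    (by rw [abs_of_nonneg] <;> norm_num)
  obtain ⟨j₀, hj₀⟩ := eventually_atTop.1 (hlim.eventually (gt_mem_nhds (show (0 : ℝ) < 1 / 8 by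
    norm_num)))
  -- With `2 * k + 1 ≤ 3 * y`, the length condition follows from `900 ≤ y ^ 2`, whence `31`.
  refine ⟨j₀ + 31, by linarith [(Nat.cast_nonneg j₀ : (0 : ℝ) ≤ j₀)], fun y hy => ?_⟩
  have hj0 : (0 : ℝ) ≤ j₀ := Nat.cast_nonneg j₀
  have hy0 : 0 ≤ y := by linarith
  set k := ⌊y⌋₊ with hk
  have hky : (k : ℝ) ≤ y := Nat.floor_le hy0
  have hyk : y < k + 1 := Nat.lt_floor_add_one y
  have hk30 : j₀ + 31 ≤ k := Nat.le_floor (by push_cast; exact hy)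
  have hk30' : (31 : ℝ) ≤ k := by
    have : 31 ≤ k := by omega
    exact_mod_cast this
  refine ⟨k, by omega, ?_, ?_⟩
  · push_cast
    have h1 : (2 * (k : ℝ) + 1) ≤ 3 * y := by linarith
    have h2 : (2 * (k : ℝ) + 1) ^ 2 ≤ (3 * y) ^ 2 := pow_le_pow_left₀ (by positivity) h1 2
    have h3 : (31 : ℝ) ^ 2 ≤ y ^ 2 := pow_le_pow_left₀ (by norm_num) (by linarith) 2
    nlinarith [sq_nonneg y]
  · have h1 := hj₀ (k + 1) (by omega)
    push_cast at h1
    have h2 : (y ^ 24) ^ 2 ≤ ((k : ℝ) + 1) ^ 48 := by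
      rw [← pow_mul]
      exact pow_le_pow_left₀ hy0 hyk.le 48
    obtain ⟨i, hi⟩ : ∃ i, k = i + 1 := ⟨k - 1, by omega⟩
    have e1 : 2 * k + 1 - 2 = 2 * i + 1 := by omega
    have e2 : 2 * k + 1 = 2 * i + 1 + 2 := by omega
    rw [e1, e2]
    have e3 : (9 / 10 : ℝ) ^ (2 * i + 1) =
        (324 / 361) ^ (k + 1) * (95 / 100) ^ (2 * i + 1) * (95 / 90) ^ 3 := by
      rw [hi, show (324 / 361 : ℝ) = (9 / 10) ^ 2 * ((95 / 100)⁻¹) ^ 2 by norm_num, mul_pow,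
        ← pow_mul, ← pow_mul, inv_pow, show 2 * (i + 1 + 1) = 2 * i + 1 + 3 by ring,
        pow_add (95 / 100 : ℝ), pow_add (9 / 10 : ℝ) (2 * i + 1) 3]
      have : (95 / 100 : ℝ) ^ (2 * i + 1) ≠ 0 := by positivity
      field_simp
      norm_num
    rw [e3, pow_add _ (2 * i + 1) 2]
    have hp : (0 : ℝ) < (95 / 100) ^ (2 * i + 1) := by positivity
    have hr : (0 : ℝ) ≤ (324 / 361) ^ (k + 1) := by positivity
    have h3 : (y ^ 24) ^ 2 * (324 / 361) ^ (k + 1) ≤ 1 / 8 :=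
      (mul_le_mul_of_nonneg_right h2 hr).trans h1.le
    have h4 := mul_le_mul_of_nonneg_right h3 hp.le
    nlinarith

end WalkLength

/-! ### Dense graphs without four-cycles. -/

section LowerBound

/-- Incidences between the points and the non-vertical lines of the affine plane over `ZMod p`. -/
def pointLineGraph (p : ℕ) : SimpleGraph ((ZMod p × ZMod p) ⊕ (ZMod p × ZMod p)) where
  Adj
    | .inl P, .inr L => P.2 = L.1 * P.1 + L.2
    | .inr L, .inl P => P.2 = L.1 * P.1 + L.2
    | _, _ => False
  symm := ⟨by rintro (P | P) (Q | Q) h <;> exact h⟩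
  loopless := ⟨by rintro (P | P) h <;> exact h⟩

theorem pointLineGraph_no_four_cycle {p : ℕ} [Fact p.Prime]
    {a b c d : (ZMod p × ZMod p) ⊕ (ZMod p × ZMod p)} (hac : a ≠ c) (hbd : b ≠ d)
    (hab : (pointLineGraph p).Adj a b) (hbc : (pointLineGraph p).Adj b c)
    (hcd : (pointLineGraph p).Adj c d) (hda : (pointLineGraph p).Adj d a) : False := by
  have key : ∀ P Q L M : ZMod p × ZMod p, P ≠ Q → L ≠ M → P.2 = L.1 * P.1 + L.2 →
      Q.2 = L.1 * Q.1 + L.2 → P.2 = M.1 * P.1 + M.2 → Q.2 = M.1 * Q.1 + M.2 → False := by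
    rintro ⟨x, y⟩ ⟨x', y'⟩ ⟨m, n⟩ ⟨m', n'⟩ hPQ hLM h1 h2 h3 h4
    simp only at h1 h2 h3 h4
    have h : (m - m') * (x - x') = 0 := by linear_combination h2 - h1 + h3 - h4
    rcases mul_eq_zero.1 h with h | h
    · have hm : m = m' := sub_eq_zero.1 h
      subst hm
      exact hLM (by rw [Prod.mk.injEq]; exact ⟨rfl, by linear_combination h3 - h1⟩)
    · have hx : x = x' := sub_eq_zero.1 h
      subst hx
      exact hPQ (by rw [Prod.mk.injEq]; exact ⟨rfl, by linear_combination h1 - h2⟩)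
  rcases a with P | L <;> rcases b with P' | L' <;> rcases c with Q | M <;> rcases d with Q' | M' <;>
    simp only [pointLineGraph] at hab hbc hcd hda
  · exact key P Q L' M' (fun h => hac (by rw [h])) (fun h => hbd (by rw [h])) hab hbc hda hcd
  · exact key P' Q' L M (fun h => hbd (by rw [h])) (fun h => hac (by rw [h])) hab hda hbc hcd

theorem le_card_edgeFinset_pointLineGraph (p : ℕ) [NeZero p]
    [Fintype (pointLineGraph p).edgeSet] : p ^ 3 ≤ (pointLineGraph p).edgeFinset.card := by
  classical
  have hcard : (Finset.univ : Finset (ZMod p × ZMod p × ZMod p)).card = p ^ 3 := by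
    rw [Finset.card_univ, Fintype.card_prod, Fintype.card_prod, ZMod.card]
    ring
  rw [← hcard]
  refine Finset.card_le_card_of_injOn
    (fun t => s(.inl (t.1, t.2.1 * t.1 + t.2.2), .inr (t.2.1, t.2.2))) ?_ ?_
  · intro t _
    rw [Finset.mem_coe, SimpleGraph.mem_edgeFinset, SimpleGraph.mem_edgeSet]
    rfl
  · rintro ⟨x, m, n⟩ _ ⟨x', m', n'⟩ _ h
    simp only [Sym2.eq_iff, Sum.inl.injEq, Sum.inr.injEq, Prod.mk.injEq, reduceCtorEq, false_and,
      or_false] at h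
    obtain ⟨⟨rfl, -⟩, rfl, rfl⟩ := h
    rfl

theorem not_hasCycleDiag_of_no_four_cycle {V : Type*} {G : SimpleGraph V}
    (h : ∀ a b c d : V, a ≠ c → b ≠ d → G.Adj a b → G.Adj b c → G.Adj c d → G.Adj d a → False) :
    ¬ HasCycleDiag G := by
  rintro ⟨ℓ, hℓ, hG⟩
  obtain ⟨a, b, c, d, h1, h2, h3, h4, h5, h6⟩ := exists_four_cycle_of_cycleGraph_four_isContained
    ((cycleGraph_four_isContained_cycleDiag hℓ).trans hG)
  exact h a b c d h1 h2 h3 h4 h5 h6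

theorem exists_graph_prime_cube_edges {n p : ℕ} (hp : p.Prime) (hpn : 2 * p ^ 2 ≤ n) :
    ∃ (G : SimpleGraph (Fin n)) (_ : DecidableRel G.Adj),
      p ^ 3 ≤ G.edgeFinset.card ∧ ¬ HasCycleDiag G := by
  classical
  have := Fact.mk hp
  obtain ⟨φ⟩ : Nonempty ((ZMod p × ZMod p) ⊕ (ZMod p × ZMod p) ↪ Fin n) := by
    refine Function.Embedding.nonempty_of_card_le ?_
    rw [Fintype.card_sum, Fintype.card_prod, ZMod.card, Fintype.card_fin]
    linarith [sq p]
  refine ⟨(pointLineGraph p).map φ, inferInstance, ?_, not_hasCycleDiag_of_no_four_cycle ?_⟩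
  · refine (le_card_edgeFinset_pointLineGraph p).trans (le_of_eq ?_)
    rw [← SimpleGraph.card_edgeFinset_map φ]
  · intro a b c d hac hbd hab hbc hcd hda
    rw [SimpleGraph.map_adj] at hab hbc hcd hda
    obtain ⟨a, b, h1, rfl, rfl⟩ := hab
    obtain ⟨b', c, h2, hb, rfl⟩ := hbc
    obtain ⟨c', d, h3, hc, rfl⟩ := hcd
    obtain ⟨d', a', h4, hd, ha⟩ := hda
    obtain rfl := φ.injective hb
    obtain rfl := φ.injective hc
    obtain rfl := φ.injective hd
    obtain rfl := φ.injective ha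
    exact pointLineGraph_no_four_cycle (fun h => hac (by rw [h])) (fun h => hbd (by rw [h]))
      h1 h2 h3 h4

theorem exists_graph_one_edge {n : ℕ} (hn : 2 ≤ n) :
    ∃ (G : SimpleGraph (Fin n)) (_ : DecidableRel G.Adj),
      1 ≤ G.edgeFinset.card ∧ ¬ HasCycleDiag G := by
  classical
  have hne : (⟨0, by omega⟩ : Fin n) ≠ ⟨1, by omega⟩ := by simp
  refine ⟨SimpleGraph.edge ⟨0, by omega⟩ ⟨1, by omega⟩, inferInstance, ?_,
    not_hasCycleDiag_of_no_four_cycle ?_⟩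
  · have key : ∀ (G : SimpleGraph (Fin n)) [DecidableRel G.Adj] (a b : Fin n), G.Adj a b →
        1 ≤ G.edgeFinset.card := fun G _ a b h =>
      Finset.card_pos.2 ⟨s(a, b), SimpleGraph.mem_edgeFinset.2 h⟩
    refine key _ ⟨0, by omega⟩ ⟨1, by omega⟩ ?_
    rw [SimpleGraph.edge_adj]
    exact ⟨Or.inl ⟨rfl, rfl⟩, hne⟩
  · intro a b c d hac hbd hab hbc hcd hda
    rw [SimpleGraph.edge_adj] at hab hbc
    rcases hab with ⟨⟨rfl, rfl⟩ | ⟨rfl, rfl⟩, -⟩ <;> rcases hbc with ⟨⟨h, rfl⟩ | ⟨h, rfl⟩, -⟩ <;>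
      simp_all

theorem exists_many_edges_not_hasCycleDiag {n : ℕ} (hn : 2 ≤ n) :
    ∃ (G : SimpleGraph (Fin n)) (_ : DecidableRel G.Adj),
      1 / 300 * (n : ℝ) ^ (3 / 2 : ℝ) ≤ (G.edgeFinset.card : ℝ) ∧ ¬ HasCycleDiag G := by
  have bound : ∀ q : ℕ, n ≤ 32 * q ^ 2 → 1 / 300 * (n : ℝ) ^ (3 / 2 : ℝ) ≤ (q : ℝ) ^ 3 := by
    intro q hq
    have h1 : (n : ℝ) ≤ 32 * (q : ℝ) ^ 2 := by exact_mod_cast hq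
    have h2 : (n : ℝ) ≤ (6 * (q : ℝ)) ^ 2 := by nlinarith [sq_nonneg (q : ℝ)]
    have h3 : (n : ℝ) ^ (3 / 2 : ℝ) ≤ ((6 * (q : ℝ)) ^ 2) ^ (3 / 2 : ℝ) :=
      Real.rpow_le_rpow (by positivity) h2 (by norm_num)
    have h4 : ((6 * (q : ℝ)) ^ 2) ^ (3 / 2 : ℝ) = (6 * (q : ℝ)) ^ 3 := by
      rw [← Real.rpow_natCast, ← Real.rpow_mul (by positivity), ← Real.rpow_natCast]
      norm_num
    rw [h4] at h3
    have : (0 : ℝ) ≤ (q : ℝ) ^ 3 := by positivity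
    nlinarith
  rcases lt_or_ge n 8 with h8 | h8
  · obtain ⟨G, hdec, hG, hG'⟩ := exists_graph_one_edge hn
    refine ⟨G, hdec, (bound 1 (by omega)).trans ?_, hG'⟩
    simpa using hG
  -- Bertrand's postulate gives a prime `p` with `k < p ≤ 2 * k`, so `2 * p ^ 2 ≤ 8 * k ^ 2 ≤ n`
  -- while `p` remains of order `√n`.
  · set k := Nat.sqrt (n / 8) with hk
    have hk1 : k ^ 2 ≤ n / 8 := Nat.sqrt_le' _
    have hk2 : n / 8 < (k + 1) ^ 2 := Nat.lt_succ_sqrt' _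
    have hk0 : k ≠ 0 := by
      rw [hk]
      exact (Nat.sqrt_pos.2 (by omega)).ne'
    obtain ⟨p, hp, hkp, hpk⟩ := Nat.exists_prime_lt_and_le_two_mul k hk0
    have hpn : 2 * p ^ 2 ≤ n := by
      have h1 : p ^ 2 ≤ (2 * k) ^ 2 := Nat.pow_le_pow_left hpk 2
      have h2 : 8 * (n / 8) ≤ n := Nat.mul_div_le n 8
      nlinarith
    obtain ⟨G, hdec, hG, hG'⟩ := exists_graph_prime_cube_edges hp hpn
    refine ⟨G, hdec, (bound p ?_).trans (by exact_mod_cast hG), hG'⟩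
    have h1 : (k + 1) ^ 2 ≤ p ^ 2 := Nat.pow_le_pow_left hkp 2
    omega

end LowerBound

/-! ### Assembling the upper bound. -/

section UpperBound

open Finset

/-- A dense graph contains a cycle with all diagonals; here `y ^ 24` is the number of vertices. -/
theorem hasCycleDiag_of_dense {V : Type*} [Fintype V] (G : SimpleGraph V) {y : ℝ} (hy : 1 ≤ y)
    (hyn : y ^ 24 = Fintype.card V) {k : ℕ} (hk : 1 ≤ k)
    (hk4 : 100 * ((2 * k + 1 : ℕ) : ℝ) ^ 2 ≤ y ^ 4)
    (hkN : 4 * (y ^ 24) ^ 2 * (9 / 10) ^ (2 * k + 1 - 2) ≤ (95 / 100 : ℝ) ^ (2 * k + 1))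
    (hE : 200 * y ^ 36 ≤ ∑ a, ∑ b, adjInd G a b) : HasCycleDiag G := by
  classical
  by_contra hG
  have hKG : ∀ a b c, a ≠ b → a ≠ c → b ≠ c →
      ∑ v, adjInd G a v * adjInd G b v * adjInd G c v ≤ 2 :=
    fun a b c => sum_adjInd_triple_le hG
  -- Thus `x = n ^ (1/6)`: degrees are capped at order `x ^ 4`, codegrees at `x ^ 2`, and each edge
  -- will lie in at least `x ^ 3` four-cycles.
  set x := y ^ 4 with hx
  have hx1 : 1 ≤ x := one_le_pow₀ hy
  have hxn : x ^ 6 = Fintype.card V := by rw [← hyn, hx, ← pow_mul]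
  have hx9 : y ^ 36 = x ^ 9 := by rw [hx, ← pow_mul]
  obtain ⟨H, hHG, hHd, hHE⟩ := exists_subgraph_degree_le G hKG hx1 hxn (K := 200) (by norm_num)
    (by rw [← hx9]; exact hE)
  have hmonoK : ∀ H' ≤ G, ∀ a b c, a ≠ b → a ≠ c → b ≠ c →
      ∑ v, adjInd H' a v * adjInd H' b v * adjInd H' c v ≤ 2 := by
    intro H' hH' a b c hab hac hbc
    refine (sum_le_sum fun v _ => ?_).trans (hKG a b c hab hac hbc)
    exact mul_le_mul (mul_le_mul (adjInd_mono hH' a v) (adjInd_mono hH' b v)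
      (adjInd_nonneg _ _ _) (adjInd_nonneg _ _ _)) (adjInd_mono hH' c v)
      (adjInd_nonneg _ _ _) (mul_nonneg (adjInd_nonneg _ _ _) (adjInd_nonneg _ _ _))
  -- Two applications of Cauchy–Schwarz. The coefficients are eight times the required `120` and, as
  -- `β` enters with a factor `2`, four times the required `x ^ 3`.
  have hpos : 0 < fourCycleCount (adjInd H) - 960 * ∑ a, (∑ b, adjInd H a b) ^ 2 -
      4 * x ^ 3 * ∑ a, ∑ b, adjInd H a b := by
    set E := ∑ a, ∑ b, adjInd H a b
    set S := ∑ a, (∑ b, adjInd H a b) ^ 2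
    set Q := fourCycleCount (adjInd H)
    have h1 : E ^ 2 ≤ x ^ 6 * S := by
      rw [hxn]; exact sq_sum_le_card_mul_sum_degree_sq _
    have h2 : S ^ 2 ≤ (x ^ 6) ^ 2 * Q := by
      rw [hxn]; exact sq_sum_degree_sq_le _ (adjInd_comm H)
    have hx0 : 0 < x := by linarith
    have hE0 : 0 < E := lt_of_lt_of_le (by positivity) hHE
    have h3 : 100 * x ^ 3 * E ≤ S := by
      have : x ^ 6 * (100 * x ^ 3 * E) ≤ x ^ 6 * S := by
        calc x ^ 6 * (100 * x ^ 3 * E) = (200 / 2 * x ^ 9) * E := by ring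
          _ ≤ E * E := mul_le_mul_of_nonneg_right hHE hE0.le
          _ = E ^ 2 := by ring
          _ ≤ _ := h1
      exact le_of_mul_le_mul_left this (by positivity)
    have h4 : 10000 * x ^ 12 ≤ S := by
      calc 10000 * x ^ 12 = 100 * x ^ 3 * (200 / 2 * x ^ 9) := by ring
        _ ≤ 100 * x ^ 3 * E := mul_le_mul_of_nonneg_left hHE (by positivity)
        _ ≤ S := h3
    have hS0 : 0 < S := lt_of_lt_of_le (by positivity) h4
    have h5 : 10000 * S ≤ Q := by
      have : x ^ 12 * (10000 * S) ≤ x ^ 12 * Q := by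
        calc x ^ 12 * (10000 * S) = (10000 * x ^ 12) * S := by ring
          _ ≤ S * S := mul_le_mul_of_nonneg_right h4 hS0.le
          _ = S ^ 2 := by ring
          _ ≤ (x ^ 6) ^ 2 * Q := h2
          _ = x ^ 12 * Q := by ring
      exact le_of_mul_le_mul_left this (by positivity)
    linarith
  obtain ⟨H', hH'H, hH'ne, hH'⟩ := exists_subgraph_many_four_cycles H (by norm_num) hpos
  have hH'G := hH'H.trans hHG
  have hx0 : 0 < x := by linarith
  have hdegnn : ∀ a, 0 ≤ ∑ b, adjInd H' a b := fun a => sum_nonneg fun b _ => adjInd_nonneg _ _ _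
  -- The choice of `τ` satisfies `4 * 21 * x ^ 4 ≤ τ ^ 2`, and `τ / t = 10 / x` is small compared
  -- with the inverse square of the length by `hk4`.
  obtain ⟨w, hw, hstep, hdisj⟩ := exists_disjoint_closed_walk (A := adjInd H') (τ := 10 * x ^ 2)
    (t := x ^ 3) (ℓ := 2 * k + 1) (adjInd_sq H') (adjInd_comm H') (adjInd_self H') (by positivity)
    (by
      intro a
      have h1 : ∑ b, adjInd H' a b ≤ ∑ b, adjInd H a b :=
        sum_le_sum fun b _ => adjInd_mono hH'H a b
      have h2 := hHd a
      have h3 : (10 * x ^ 2) ^ 2 = 100 * x ^ 4 := by ring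
      have h4 : 0 < x ^ 4 := by positivity
      linarith)
    (hmonoK H' hH'G)
    (by
      obtain ⟨a, b, hab⟩ := SimpleGraph.ne_bot_iff_exists_adj.1 hH'ne
      exact ⟨a, b, adjInd_ne_zero.2 hab⟩)
    (by positivity)
    (by
      intro a b hab
      have h1 := hH' a b (adjInd_ne_zero.1 hab)
      have h2 : 0 < x ^ 3 := by positivity
      linarith)
    (by
      intro a b hab
      have h1 := hH' a b (adjInd_ne_zero.1 hab)
      have h2 := hdegnn a
      have h3 := hdegnn b
      linarith)
    (by omega)
    (by
      have h2 : 0 ≤ x ^ 2 := by positivity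
      have h1 := mul_le_mul_of_nonneg_left hk4 h2
      nlinarith)
    (by rw [← hyn]; exact hkN)
  have hadj : ∀ i : Fin (2 * k + 1), G.Adj (w i.castSucc).1 (w i.castSucc).2 ∧
      G.Adj (w i.castSucc).1 (w i.succ).2 ∧ G.Adj (w i.castSucc).2 (w i.succ).1 := by
    intro i
    have := hstep i
    rw [lightStep] at this
    simp only [mul_ne_zero_iff, adjInd_ne_zero] at this
    exact ⟨hH'G this.1.1.1.1, hH'G this.1.2, (hH'G this.1.1.1.2).symm⟩
  obtain ⟨p, hext⟩ : ∃ p : ℕ → V × V, ∀ (i : ℕ) (hi : i < 2 * k + 1),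
      p i = w (Fin.castSucc ⟨i, hi⟩) ∧ p (i + 1) = w (Fin.succ ⟨i, hi⟩) := by
    refine ⟨fun j => if h : j < 2 * k + 2 then w ⟨j, h⟩ else w 0, fun i hi => ⟨?_, ?_⟩⟩
    · simp only [dif_pos (show i < 2 * k + 2 by omega)]
      rfl
    · simp only [dif_pos (show i + 1 < 2 * k + 2 by omega)]
      rfl
  refine hG (hasCycleDiag_of_walk hk p ?_ ?_ ?_ ?_ ?_)
  · intro i hi
    rw [(hext i hi).1]
    exact (hadj ⟨i, hi⟩).1
  · intro i hi
    rw [(hext i hi).1, (hext i hi).2]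
    exact (hadj ⟨i, hi⟩).2.1
  · intro i hi
    rw [(hext i hi).1, (hext i hi).2]
    exact (hadj ⟨i, hi⟩).2.2
  · rw [(hext (2 * k) (by omega)).2, (hext 0 (by omega)).1]
    exact hw.symm
  · intro i hi j hj
    rw [(hext i hi).1, (hext j (by omega)).1]
    have h := hdisj ⟨j, by omega⟩ ⟨i, hi⟩ hj
    have h1 := h _ (Or.inl rfl)
    have h2 := h _ (Or.inr rfl)
    push Not at h1 h2
    exact ⟨h1.1, h2.1, h1.2, h2.2⟩

end UpperBound

theorem theorem1 :
    -- an absolute constant `C` such that `C n ^ (3/2)` edges force a cycle with all diagonals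
    (∃ C : ℝ, 0 < C ∧
      ∀ (V : Type*) [Fintype V] [Nonempty V] (G : SimpleGraph V) [DecidableRel G.Adj],
        C * (Fintype.card V : ℝ) ^ (3 / 2 : ℝ) ≤ (G.edgeFinset.card : ℝ) → HasCycleDiag G) ∧
    -- every cycle with all diagonals contains a four-cycle
    (∀ ℓ : ℕ, 2 ≤ ℓ → SimpleGraph.cycleGraph 4 ⊑ cycleDiag ℓ) ∧
    -- the order of magnitude `n ^ (3/2)` is best possible
    (∃ c : ℝ, 0 < c ∧
      ∀ n : ℕ, 2 ≤ n → ∃ (G : SimpleGraph (Fin n)) (_ : DecidableRel G.Adj),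
        c * (n : ℝ) ^ (3 / 2 : ℝ) ≤ (G.edgeFinset.card : ℝ) ∧ ¬ HasCycleDiag G) := by
  refine ⟨?_, fun ℓ hℓ => cycleGraph_four_isContained_cycleDiag hℓ, 1 / 300, by norm_num,
    fun n hn => exists_many_edges_not_hasCycleDiag hn⟩
  obtain ⟨y₀, hy₀, hlen⟩ := exists_walk_length
  -- The `100` becomes `200` on summing over ordered pairs. The term `y₀ ^ 12` makes the hypothesis
  -- fail for small graphs: there are at most `y ^ 48 = n ^ 2` edges, so `y₀ ^ 12 * y ^ 36 ≤ y ^ 48`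
  -- forces `y₀ ≤ y`.
  refine ⟨100 + y₀ ^ 12, by positivity, fun V _ _ G _ hG => ?_⟩
  set n : ℝ := (Fintype.card V : ℝ) with hn
  have hn1 : 1 ≤ n := by
    rw [hn]
    exact_mod_cast Fintype.card_pos
  set y : ℝ := n ^ (1 / 24 : ℝ) with hy
  have hy1 : 1 ≤ y := Real.one_le_rpow hn1 (by norm_num)
  have hyn : y ^ 24 = n := by
    rw [hy, ← Real.rpow_natCast, ← Real.rpow_mul (by linarith)]
    norm_num
  have hy36 : n ^ (3 / 2 : ℝ) = y ^ 36 := by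
    rw [hy, ← Real.rpow_natCast, ← Real.rpow_mul (by linarith)]
    norm_num
  have hsum := sum_adjInd_eq G
  rw [hy36] at hG
  have hy0 : 0 ≤ y₀ ^ 12 := by positivity
  have hyy : y₀ ≤ y := by
    have hub : (G.edgeFinset.card : ℝ) ≤ y ^ 48 := by
      have h1 : ∑ a, ∑ b, adjInd G a b ≤ ∑ _a : V, ∑ _b : V, (1 : ℝ) :=
        Finset.sum_le_sum fun a _ => Finset.sum_le_sum fun b _ => adjInd_le_one G a b
      simp only [Finset.sum_const, Finset.card_univ, nsmul_eq_mul, mul_one] at h1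
      rw [hsum, ← hn, ← hyn] at h1
      have h2 : y ^ 24 * y ^ 24 = y ^ 48 := by ring
      have h3 : (0 : ℝ) ≤ G.edgeFinset.card := by positivity
      linarith
    have h1 : y₀ ^ 12 * y ^ 36 ≤ y ^ 12 * y ^ 36 := by
      have : 0 ≤ 100 * y ^ 36 := by positivity
      have h2 : y ^ 12 * y ^ 36 = y ^ 48 := by ring
      linarith
    have h2 := le_of_mul_le_mul_right h1 (by positivity)
    exact le_of_pow_le_pow_left₀ (by norm_num) (by linarith) h2
  obtain ⟨k, hk, hk4, hkN⟩ := hlen y hyy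
  refine hasCycleDiag_of_dense G hy1 hyn hk hk4 hkN ?_
  rw [hsum]
  have : 0 ≤ y₀ ^ 12 * y ^ 36 := by positivity
  linarith
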